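/- Let $\mathcal Y\subset\mathbb R^p$ and $\mathcal Z\subset\mathbb R^q$ be bounded open sets, and let $\Omega=\mathcal Y\times\mathcal Z=\{(y,z): y\in\mathcal Y,\ z\in\mathcal Z\}\subset\mathbb R^{p+q}$. All functions are real valued. For a bounded open set $D$, the space $H^1(D)$ consists of the $u\in L^2(D)$ with weak gradient $\nabla u\in L^2(D)$, with inner product $\int_D uv+\int_D\nabla u\cdot\nabla v$, and $H^1_0(D)$ is the closure in $H^1(D)$ of the smooth functions with compact support in $D$. For $\Gamma\subset\partial D$, let $H^1_\Gamma(D)$ be the closure in $H^1(D)$ of the set of $u\in H^1(D)$ that vanish, for some $\varepsilon>0$, almost everywhere in $\{x\in D:\ |x-x'|<\varepsilon\text{ for some }x'\in\Gamma\}$. For a subspace $V\subset H^1(D)$, an eigenpair of $-\Delta$ on $V$ is a pair $(\Lambda,u)$ with $\Lambda\in\mathbb R$, $u\in V$, $u\ne0$, and $\int_D\nabla u\cdot\nabla\varphi=\Lambda\int_D u\,\varphi$ for all $\varphi\in V$. A spectral sequence of $-\Delta$ on $V$ is a sequence of eigenpairs $(\lambda_j,v_j)_{j\ge1}$ of $-\Delta$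 on $V$ such that $\lambda_1\le\lambda_2\le\dots$ and $(v_j)_{j\ge1}$ is an orthonormal basis of $L^2(D)$. **Theorem.** Let $(V_{\mathcal Y},V_{\mathcal Z},V)$ be one of the following triples: 1. (Dirichlet) $\bigl(H^1_0(\mathcal Y),\,H^1_0(\mathcal Z),\,H^1_0(\Omega)\bigr)$; 2. (Neumann) $\bigl(H^1(\mathcal Y),\,H^1(\mathcal Z),\,H^1(\Omega)\bigr)$; 3. (Dirichlet on $\partial\mathcal Y\times\mathcal Z$, Neumann on $\mathcal Y\times\partial\mathcal Z$) $\bigl(H^1_0(\mathcal Y),\,H^1(\mathcal Z),\,H^1_{\partial\mathcal Y\times\mathcal Z}(\Omega)\bigr)$; 4. (Neumann on $\partial\mathcal Y\times\mathcal Z$, Dirichlet on $\mathcal Y\times\partial\mathcal Z$) $\bigl(H^1(\mathcal Y),\,H^1_0(\mathcal Z),\,H^1_{\mathcal Y\times\partial\mathcal Z}(\Omega)\bigr)$. Let $(\lambda_j,v_j)_{j\ge1}$ and $(\mu_m,w_m)_{m\ge1}$ be spectral sequences of $-\Delta$ on $V_{\mathcal Y}$ and on $V_{\mathcal Z}$,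 respectively. Then the set of eigenvalues of $-\Delta$ on $V$ is $$\{\lambda_j+\mu_m:\ j\ge1,\ m\ge1\}.$$ Moreover, the functions $u_{j,m}(y,z)=v_j(y)\,w_m(z)$ belong to $V$, each $(\lambda_j+\mu_m,u_{j,m})$ is an eigenpair of $-\Delta$ on $V$, and $(u_{j,m})_{j,m\ge1}$ is an orthonormal basis of $L^2(\Omega)$. Finally, the $u_{j,m}$ form an orthogonal basis of $V$: they are pairwise orthogonal in $H^1(\Omega)$, and each $f\in V$ has a unique expansion $f=\sum_{j,m}c_{j,m}u_{j,m}$ that converges unconditionally in $H^1(\Omega)$. -/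

import Mathlib

open MeasureTheory TopologicalSpace
open scoped Distributions Gradient InnerProductSpace

noncomputable section

namespace ProductSpectrum

section Sobolev

set_option linter.unusedSectionVars false

variable {E : Type*} [NormedAddCommGroup E] [InnerProductSpace ℝ E] [FiniteDimensional ℝ E]
  [MeasurableSpace E] [BorelSpace E]

/-- `L²(Ω; G)` for the Lebesgue measure on the open set `Ω`. -/
abbrev L2 (Ω : Opens E) (G : Type*) [NormedAddCommGroup G] : Type _ :=
  Lp G 2 ((volume : Measure E).restrict (Ω : Set E))

/-- `g` is the weak gradient of `u` in `Ω`: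
`∫_Ω u ∇φ = - ∫_Ω φ g` for every smooth `φ` with compact support in `Ω`. -/
def IsWeakGradient (Ω : Opens E) (u : L2 Ω ℝ) (g : L2 Ω E) : Prop :=
  ∀ φ : 𝓓(Ω, ℝ), ∫ x in (Ω : Set E), u x • ∇ (φ : E → ℝ) x = - ∫ x in (Ω : Set E), φ x • g x

theorem continuous_gradient_testFunction {Ω : Opens E} (φ : 𝓓(Ω, ℝ)) :
    Continuous (∇ (φ : E → ℝ)) :=
  (InnerProductSpace.toDual ℝ E).symm.continuous.comp
    (φ.contDiff.continuous_fderiv (by simp))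

theorem hasCompactSupport_gradient_testFunction {Ω : Opens E} (φ : 𝓓(Ω, ℝ)) :
    HasCompactSupport (∇ (φ : E → ℝ)) :=
  (φ.hasCompactSupport.fderiv ℝ).comp_left (g := (InnerProductSpace.toDual ℝ E).symm)
    (map_zero _)

theorem integrable_smul_gradient {Ω : Opens E} (u : L2 Ω ℝ) (φ : 𝓓(Ω, ℝ)) :
    Integrable (fun x => u x • ∇ (φ : E → ℝ) x) (volume.restrict (Ω : Set E)) :=
  memLp_one_iff_integrable.1 (MemLp.smul (p := 2) (q := 2) (r := 1)
    ((continuous_gradient_testFunction φ).memLp_of_hasCompactSupport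
      (hasCompactSupport_gradient_testFunction φ)) (Lp.memLp u))

theorem integrable_smul_testFunction {Ω : Opens E} (g : L2 Ω E) (φ : 𝓓(Ω, ℝ)) :
    Integrable (fun x => φ x • g x) (volume.restrict (Ω : Set E)) :=
  memLp_one_iff_integrable.1 (MemLp.smul (p := 2) (q := 2) (r := 1) (Lp.memLp g)
    (φ.continuous.memLp_of_hasCompactSupport φ.hasCompactSupport))

/-- The Sobolev space `H¹(Ω)`: pairs `(u, ∇u)` of a function `u ∈ L²(Ω)` and its weak gradient
`∇u ∈ L²(Ω; E)`, with the inner product `∫_Ω u v + ∫_Ω ∇u · ∇v`. -/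
def H1 (Ω : Opens E) : Submodule ℝ (WithLp 2 (L2 Ω ℝ × L2 Ω E)) where
  carrier := {U | IsWeakGradient Ω U.fst U.snd}
  zero_mem' := by
    intro φ
    have h1 : ∫ x in (Ω : Set E), ((0 : L2 Ω ℝ) x) • ∇ (φ : E → ℝ) x = 0 := by
      rw [integral_congr_ae (g := fun _ => (0 : E)), integral_zero]
      filter_upwards [Lp.coeFn_zero ℝ 2 (volume.restrict (Ω : Set E))] with x hx
      rw [hx]
      simp
    have h2 : ∫ x in (Ω : Set E), φ x • ((0 : L2 Ω E) x) = 0 := by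
      rw [integral_congr_ae (g := fun _ => (0 : E)), integral_zero]
      filter_upwards [Lp.coeFn_zero E 2 (volume.restrict (Ω : Set E))] with x hx
      rw [hx]
      simp
    simp only [WithLp.zero_fst, WithLp.zero_snd]
    rw [h1, h2, neg_zero]
  add_mem' := by
    intro U V hU hV φ
    have h1 : ∫ x in (Ω : Set E), ((U.fst + V.fst : L2 Ω ℝ) x) • ∇ (φ : E → ℝ) x
        = (∫ x in (Ω : Set E), U.fst x • ∇ (φ : E → ℝ) x)
          + ∫ x in (Ω : Set E), V.fst x • ∇ (φ : E → ℝ) x := by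
      rw [← integral_add (integrable_smul_gradient _ φ) (integrable_smul_gradient _ φ)]
      refine integral_congr_ae ?_
      filter_upwards [Lp.coeFn_add U.fst V.fst] with x hx
      simp only [hx, Pi.add_apply, add_smul]
    have h2 : ∫ x in (Ω : Set E), φ x • ((U.snd + V.snd : L2 Ω E) x)
        = (∫ x in (Ω : Set E), φ x • U.snd x) + ∫ x in (Ω : Set E), φ x • V.snd x := by
      rw [← integral_add (integrable_smul_testFunction _ φ) (integrable_smul_testFunction _ φ)]
      refine integral_congr_ae ?_
      filter_upwards [Lp.coeFn_add U.snd V.snd] with x hx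
      simp only [hx, Pi.add_apply, smul_add]
    simp only [WithLp.add_fst, WithLp.add_snd]
    rw [h1, h2, hU φ, hV φ, neg_add]
  smul_mem' := by
    intro c U hU φ
    have h1 : ∫ x in (Ω : Set E), ((c • U.fst : L2 Ω ℝ) x) • ∇ (φ : E → ℝ) x
        = c • ∫ x in (Ω : Set E), U.fst x • ∇ (φ : E → ℝ) x := by
      rw [← integral_smul]
      refine integral_congr_ae ?_
      filter_upwards [Lp.coeFn_smul c U.fst] with x hx
      simp only [hx, Pi.smul_apply, smul_eq_mul, mul_smul]
    have h2 : ∫ x in (Ω : Set E), φ x • ((c • U.snd : L2 Ω E) x)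
        = c • ∫ x in (Ω : Set E), φ x • U.snd x := by
      rw [← integral_smul]
      refine integral_congr_ae ?_
      filter_upwards [Lp.coeFn_smul c U.snd] with x hx
      simp only [hx, Pi.smul_apply, smul_comm c]
    simp only [WithLp.smul_fst, WithLp.smul_snd]
    rw [h1, h2, hU φ, smul_neg]

/-- The underlying `L²` function of an element of `H¹(Ω)`. -/
def H1.fn {Ω : Opens E} (u : H1 Ω) : L2 Ω ℝ := u.1.fst

/-- The weak gradient of an element of `H¹(Ω)`. -/
def H1.grad {Ω : Opens E} (u : H1 Ω) : L2 Ω E := u.1.snd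

/-- The elements of `H¹(Ω)` that are smooth functions with compact support in `Ω`. -/
def testSubspace (Ω : Opens E) : Submodule ℝ (H1 Ω) where
  carrier := {u | ∃ φ : 𝓓(Ω, ℝ), H1.fn u =ᵐ[volume.restrict (Ω : Set E)] φ}
  zero_mem' := ⟨0, Lp.coeFn_zero ℝ 2 (volume.restrict (Ω : Set E))⟩
  add_mem' := by
    rintro u v ⟨φ, hφ⟩ ⟨ψ, hψ⟩
    exact ⟨φ + ψ, (Lp.coeFn_add (H1.fn u) (H1.fn v)).trans (hφ.add hψ)⟩
  smul_mem' := by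
    rintro c u ⟨φ, hφ⟩
    exact ⟨c • φ, (Lp.coeFn_smul c (H1.fn u)).trans (hφ.const_smul c)⟩

/-- `H¹₀(Ω)`: the closure in `H¹(Ω)` of the smooth functions with compact support in `Ω`
(Dirichlet condition on the whole boundary). -/
def H10 (Ω : Opens E) : Submodule ℝ (H1 Ω) := (testSubspace Ω).topologicalClosure

/-- The elements of `H¹(Ω)` that vanish on a uniform neighbourhood of the set `Γ`. -/
def vanishingNear (Ω : Opens E) (Γ : Set E) : Submodule ℝ (H1 Ω) where
  carrier := {u | ∃ ε > (0 : ℝ), ∀ᵐ x ∂(volume.restrict (Ω : Set E)),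
    (∃ y ∈ Γ, dist x y < ε) → H1.fn u x = 0}
  zero_mem' := by
    refine ⟨1, one_pos, ?_⟩
    filter_upwards [Lp.coeFn_zero ℝ 2 (volume.restrict (Ω : Set E))] with x hx _
    exact hx
  add_mem' := by
    rintro u v ⟨ε, hε, hu⟩ ⟨δ, hδ, hv⟩
    refine ⟨min ε δ, lt_min hε hδ, ?_⟩
    filter_upwards [hu, hv, Lp.coeFn_add (H1.fn u) (H1.fn v)] with x hxu hxv hx
    rintro ⟨y, hy, hxy⟩
    refine hx.trans ?_
    simp [hxu ⟨y, hy, hxy.trans_le (min_le_left _ _)⟩,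
      hxv ⟨y, hy, hxy.trans_le (min_le_right _ _)⟩]
  smul_mem' := by
    rintro c u ⟨ε, hε, hu⟩
    refine ⟨ε, hε, ?_⟩
    filter_upwards [hu, Lp.coeFn_smul c (H1.fn u)] with x hxu hx hΓ
    refine hx.trans ?_
    simp [hxu hΓ]

/-- The closure in `H¹(Ω)` of the functions vanishing near the part `Γ` of the boundary: the form
domain of the mixed problem with a Dirichlet condition on `Γ` and a Neumann condition on the rest
of the boundary. -/
def H1Mixed (Ω : Opens E) (Γ : Set E) : Submodule ℝ (H1 Ω) :=
  (vanishingNear Ω Γ).topologicalClosure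

/-- The form domain `H¹(Ω)` of the Neumann problem. -/
def H1Full (Ω : Opens E) : Submodule ℝ (H1 Ω) := ⊤

/-- `u` is an eigenvector of `-Δ` with eigenvalue `Λ` for the boundary conditions given by the form
domain `V ⊆ H¹(Ω)`: `u ∈ V`, `u ≠ 0` and `∫_Ω ∇u · ∇φ = Λ ∫_Ω u φ` for all `φ ∈ V`. -/
def IsEigenpair {Ω : Opens E} (V : Submodule ℝ (H1 Ω)) (Λ : ℝ) (u : H1 Ω) : Prop :=
  u ∈ V ∧ u ≠ 0 ∧
    ∀ φ ∈ V, ⟪H1.grad u, H1.grad φ⟫_ℝ = Λ * ⟪H1.fn u, H1.fn φ⟫_ℝ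

/-- The set of eigenvalues of `-Δ` on the form domain `V`. -/
def eigenvalues {Ω : Opens E} (V : Submodule ℝ (H1 Ω)) : Set ℝ :=
  {Λ | ∃ u, IsEigenpair V Λ u}

/-- The family `u` of elements of `H¹(Ω)` is an orthonormal (Hilbert) basis of `L²(Ω)`. -/
def IsOrthonormalBasisL2 {Ω : Opens E} {ι : Type*} (u : ι → H1 Ω) : Prop :=
  Orthonormal ℝ (fun i => H1.fn (u i)) ∧
    (Submodule.span ℝ (Set.range fun i => H1.fn (u i))).topologicalClosure = ⊤

/-- The family `u` is an orthogonal basis of the closed subspace `V` of the Hilbert space `H¹(Ω)`: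
it consists of pairwise `H¹`-orthogonal elements of `V`, and every element of `V` has exactly one
expansion `∑ i, c i • u i`, convergent (unconditionally) in the norm of `H¹(Ω)`. -/
def IsOrthogonalBasisH1 {Ω : Opens E} (V : Submodule ℝ (H1 Ω)) {ι : Type*} (u : ι → H1 Ω) :
    Prop :=
  (∀ i, u i ∈ V) ∧ (Pairwise fun i j => ⟪u i, u j⟫_ℝ = 0) ∧
    ∀ f ∈ V, ∃! c : ι → ℝ, HasSum (fun i => c i • u i) f

/-- `(lam j, v j)` is the spectral sequence of `-Δ` on the form domain `V`: a nondecreasing sequence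
of eigenvalues with eigenvectors forming an orthonormal basis of `L²(Ω)`. -/
def IsSpectralSequence {Ω : Opens E} (V : Submodule ℝ (H1 Ω)) (lam : ℕ → ℝ) (v : ℕ → H1 Ω) :
    Prop :=
  Monotone lam ∧ (∀ j, IsEigenpair V (lam j) (v j)) ∧ IsOrthonormalBasisL2 v

end Sobolev

section Product

variable {E : Type*} [NormedAddCommGroup E] [InnerProductSpace ℝ E] [FiniteDimensional ℝ E]
  [MeasurableSpace E] [BorelSpace E]
  {F : Type*} [NormedAddCommGroup F] [InnerProductSpace ℝ F] [FiniteDimensional ℝ F]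
  [MeasurableSpace F] [BorelSpace F]

/-- The product domain `Y × Z` in the Euclidean space `E × F` of points `x = (y, z)`
(with `‖x‖² = ‖y‖² + ‖z‖²`). -/
def prodDomain (Y : Opens E) (Z : Opens F) : Opens (WithLp 2 (E × F)) where
  carrier := {x | x.fst ∈ Y ∧ x.snd ∈ Z}
  is_open' := (Y.isOpen.preimage (WithLp.continuous_fst 2 E F)).inter
    (Z.isOpen.preimage (WithLp.continuous_snd 2 E F))

/-- The part `∂Y × Z` of the boundary of `Y × Z`. -/
def bdryLeft (Y : Opens E) (Z : Opens F) : Set (WithLp 2 (E × F)) :=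
  {x | x.fst ∈ frontier (Y : Set E) ∧ x.snd ∈ Z}

/-- The part `Y × ∂Z` of the boundary of `Y × Z`. -/
def bdryRight (Y : Opens E) (Z : Opens F) : Set (WithLp 2 (E × F)) :=
  {x | x.fst ∈ Y ∧ x.snd ∈ frontier (Z : Set F)}

/-- `u` is the tensor product `v ⊗ w`, that is `u(y, z) = v(y) w(z)` almost everywhere. -/
def IsTensor {Y : Opens E} {Z : Opens F} (u : H1 (prodDomain Y Z)) (v : H1 Y) (w : H1 Z) : Prop :=
  ∀ᵐ x ∂((volume : Measure (WithLp 2 (E × F))).restrict (prodDomain Y Z : Set (WithLp 2 (E × F)))),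
    H1.fn u x = H1.fn v x.fst * H1.fn w x.snd

/-- The spectral description of `-Δ` on the form domain `V ⊆ H¹(Y × Z)` by sums of eigenvalues and
tensor products of eigenvectors of the two factors: the set of eigenvalues is
`{lam j + mu m}`, and the functions `v j ⊗ w m` lie in `V`, are associated eigenvectors, form an
orthonormal basis of `L²(Y × Z)` and a basis of `V`. -/
def HasTensorSpectrum {Y : Opens E} {Z : Opens F} (V : Submodule ℝ (H1 (prodDomain Y Z)))
    (lam : ℕ → ℝ) (v : ℕ → H1 Y) (mu : ℕ → ℝ) (w : ℕ → H1 Z) : Prop :=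
  eigenvalues V = {Λ | ∃ j m, Λ = lam j + mu m} ∧
  ∃ u : ℕ × ℕ → H1 (prodDomain Y Z),
    (∀ j m, IsTensor (u (j, m)) (v j) (w m)) ∧
    (∀ j m, IsEigenpair V (lam j + mu m) (u (j, m))) ∧
    IsOrthonormalBasisL2 u ∧
    IsOrthogonalBasisH1 V u

end Product

end ProductSpectrum

end

/-!
The proof is separation of variables carried out with Hilbert space adjoints, without slices of
`L²` functions. For `h ∈ L²(Z)` the partial integral `f ↦ ∫ h(z) f(·, z) dz` is defined as the
adjoint `ProductChart.partialInt` of the tensor product `g ↦ g ⊗ h` from `L²(Y)` to `L²(Y × Z)`.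
It commutes with derivatives in the remaining variable (`ProductChart.isWeakGradient_partialInt`),
so it maps `H¹(Y × Z)` to `H¹(Y)`. The same is true of the other factor by the symmetry
`ProductChart.swap`.

For Sobolev functions `v` and `w`, the product `v ⊗ w` is a Sobolev function whose gradient is given
by the product rule, and its Dirichlet form against any `f` is the sum of the Dirichlet forms of `v`
and `w` against the two partial integrals of `f` (`ProductChart.inner_grad_tensorH1`). Therefore, if
the form domains are compatible with tensor products and with partial integration, tensor products
of eigenfunctions are eigenfunctions for the sums of the eigenvalues. They are orthonormal by
Fubini's theorem, and complete because a function orthogonal to all of them has vanishing partial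
integrals, so its integral over every measurable rectangle is zero. Since on the form domain the
`H¹` inner product with an eigenfunction is a positive multiple of the `L²` inner product, an `L²`
orthonormal basis of eigenfunctions is also an orthogonal basis of the form domain and leaves no
room for further eigenvalues (`hasTensorSpectrum_of_tensor_of_partial`).

It remains to check the compatibility for each boundary condition. The only analytic input is
`mem_H10_of_ae_eq_zero`: a Sobolev function that vanishes outside a compact subset of the domain is
in `H¹₀`, which is proved by mollification. The partial integral of a test function has this
property, and so has the partial integral over `Z` of a function that vanishes near `∂Y × Z`,
because `Y` is bounded.
-/

noncomputable section

namespace ProductSpectrum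

/-! ### Tensor products of square integrable functions -/

section TensorL2

variable {α β X : Type*} [MeasurableSpace α] [MeasurableSpace β] [MeasurableSpace X]
  {μ : Measure α} {ν : Measure β} {ρ : Measure X}
  {G : Type*} [NormedAddCommGroup G] [InnerProductSpace ℝ G]
  {G' : Type*} [NormedAddCommGroup G'] [InnerProductSpace ℝ G']

theorem ae_comp_fst {π : X → α × β} (hπ : MeasurePreserving π ρ (μ.prod ν)) {p : α → Prop}
    (hp : ∀ᵐ a ∂μ, p a) : ∀ᵐ x ∂ρ, p (π x).1 :=
  (Measure.quasiMeasurePreserving_fst.comp hπ.quasiMeasurePreserving).ae hp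

theorem ae_comp_snd {π : X → α × β} (hπ : MeasurePreserving π ρ (μ.prod ν)) {p : β → Prop}
    (hp : ∀ᵐ b ∂ν, p b) : ∀ᵐ x ∂ρ, p (π x).2 :=
  (Measure.quasiMeasurePreserving_snd.comp hπ.quasiMeasurePreserving).ae hp

theorem memLp_two_prod_smul {g : α → G} {h : β → ℝ} (hg : MemLp g 2 μ) (hh : MemLp h 2 ν) :
    MemLp (fun p : α × β => h p.2 • g p.1) 2 (μ.prod ν) := by
  have hm : AEStronglyMeasurable (fun p : α × β => h p.2 • g p.1) (μ.prod ν) :=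
    hh.1.comp_snd.smul hg.1.comp_fst
  rw [memLp_two_iff_integrable_sq_norm hm]
  refine (hg.integrable_norm_pow (by norm_num)).mul_prod
    (hh.integrable_norm_pow (by norm_num)) |>.congr (Filter.Eventually.of_forall fun p => ?_)
  simp only [norm_smul, mul_pow]
  norm_num [mul_comm]

/-- The tensor product `g ⊗ h` of two square integrable functions, transported to `X` by the
measure preserving map `π : X → α × β`. -/
def tensorLp {π : X → α × β} (hπ : MeasurePreserving π ρ (μ.prod ν)) (g : Lp G 2 μ)
    (h : Lp ℝ 2 ν) : Lp G 2 ρ :=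
  ((memLp_two_prod_smul (Lp.memLp g) (Lp.memLp h)).comp_measurePreserving hπ).toLp _

variable {π : X → α × β} (hπ : MeasurePreserving π ρ (μ.prod ν))

theorem coeFn_tensorLp (g : Lp G 2 μ) (h : Lp ℝ 2 ν) :
    tensorLp hπ g h =ᵐ[ρ] fun x => h (π x).2 • g (π x).1 :=
  MemLp.coeFn_toLp _

variable [SFinite μ] [SFinite ν]

theorem inner_tensorLp (g g' : Lp G 2 μ) (h h' : Lp ℝ 2 ν) :
    ⟪tensorLp hπ g h, tensorLp hπ g' h'⟫_ℝ = ⟪g, g'⟫_ℝ * ⟪h, h'⟫_ℝ := by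
  simp only [L2.inner_def]
  have hint : AEStronglyMeasurable (fun p : α × β => ⟪g p.1, g' p.1⟫_ℝ * ⟪h p.2, h' p.2⟫_ℝ)
      (μ.prod ν) :=
    (((Lp.memLp g).1.inner (𝕜 := ℝ) (Lp.memLp g').1).comp_fst).mul
      (((Lp.memLp h).1.inner (𝕜 := ℝ) (Lp.memLp h').1).comp_snd)
  rw [← integral_prod_mul, ← hπ.map_eq, integral_map hπ.measurable.aemeasurable
    (by rw [hπ.map_eq]; exact hint)]
  refine integral_congr_ae ?_
  filter_upwards [coeFn_tensorLp hπ g h, coeFn_tensorLp hπ g' h'] with x h1 h2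
  rw [h1, h2, real_inner_smul_left, real_inner_smul_right]
  simp only [RCLike.inner_apply, conj_trivial]
  ring

theorem norm_tensorLp (g : Lp G 2 μ) (h : Lp ℝ 2 ν) : ‖tensorLp hπ g h‖ = ‖g‖ * ‖h‖ := by
  have := inner_tensorLp hπ g g h h
  simp only [real_inner_self_eq_norm_sq] at this
  rw [← mul_pow] at this
  exact (pow_left_inj₀ (by positivity) (by positivity) two_ne_zero).1 this

/-- The tensor product of square integrable functions as a continuous bilinear map. -/
def tensorL : Lp G 2 μ →L[ℝ] Lp ℝ 2 ν →L[ℝ] Lp G 2 ρ :=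
  LinearMap.mkContinuous₂
    (LinearMap.mk₂ ℝ (tensorLp hπ)
      (fun g g' h => by
        refine Lp.ext ?_
        filter_upwards [coeFn_tensorLp hπ (g + g') h, coeFn_tensorLp hπ g h,
          coeFn_tensorLp hπ g' h, Lp.coeFn_add (tensorLp hπ g h) (tensorLp hπ g' h),
          ae_comp_fst hπ (Lp.coeFn_add g g')] with x h1 h2 h3 h4 h5
        rw [h1, h5, h4, Pi.add_apply, smul_add, Pi.add_apply, h2, h3])
      (fun c g h => by
        refine Lp.ext ?_
        filter_upwards [coeFn_tensorLp hπ (c • g) h, coeFn_tensorLp hπ g h,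
          Lp.coeFn_smul c (tensorLp hπ g h), ae_comp_fst hπ (Lp.coeFn_smul c g)] with x h1 h2 h3 h4
        simp [h1, h2, h3, h4, smul_comm c])
      (fun g h h' => by
        refine Lp.ext ?_
        filter_upwards [coeFn_tensorLp hπ g (h + h'), coeFn_tensorLp hπ g h,
          coeFn_tensorLp hπ g h', Lp.coeFn_add (tensorLp hπ g h) (tensorLp hπ g h'),
          ae_comp_snd hπ (Lp.coeFn_add h h')] with x h1 h2 h3 h4 h5
        rw [h1, h5, h4, Pi.add_apply, add_smul, Pi.add_apply, h2, h3])
      (fun c g h => by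
        refine Lp.ext ?_
        filter_upwards [coeFn_tensorLp hπ g (c • h), coeFn_tensorLp hπ g h,
          Lp.coeFn_smul c (tensorLp hπ g h), ae_comp_snd hπ (Lp.coeFn_smul c h)] with x h1 h2 h3 h4
        simp [h1, h2, h3, h4, mul_smul]))
    1 (fun g h => by simp [norm_tensorLp])

theorem coeFn_tensorL (g : Lp G 2 μ) (h : Lp ℝ 2 ν) :
    tensorL hπ g h =ᵐ[ρ] fun x => h (π x).2 • g (π x).1 :=
  coeFn_tensorLp hπ g h

theorem inner_tensorL (g g' : Lp G 2 μ) (h h' : Lp ℝ 2 ν) :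
    ⟪tensorL hπ g h, tensorL hπ g' h'⟫_ℝ = ⟪g, g'⟫_ℝ * ⟪h, h'⟫_ℝ :=
  inner_tensorLp hπ g g' h h'

theorem compLpL_tensorL (A : G →L[ℝ] G') (g : Lp G 2 μ) (h : Lp ℝ 2 ν) :
    A.compLpL 2 ρ (tensorL hπ g h) = tensorL hπ (A.compLpL 2 μ g) h := by
  refine Lp.ext ?_
  filter_upwards [A.coeFn_compLpL (tensorL hπ g h), coeFn_tensorL hπ g h,
    coeFn_tensorL hπ (A.compLpL 2 μ g) h, ae_comp_fst hπ (A.coeFn_compLpL g)] with x h1 h2 h3 h4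
  simp [h1, h2, h3, h4]

theorem tensorL_swap (hπ' : MeasurePreserving (fun x => (π x).swap) ρ (ν.prod μ))
    (g : Lp ℝ 2 μ) (h : Lp ℝ 2 ν) : tensorL hπ' h g = tensorL hπ g h := by
  refine Lp.ext ?_
  filter_upwards [coeFn_tensorL hπ' h g, coeFn_tensorL hπ g h] with x h1 h2
  simp [h1, h2, mul_comm]

/-- A square integrable function on a product that is orthogonal to all tensor products
vanishes: its integral over every measurable rectangle is zero, and rectangles generate the
product σ-algebra. -/
theorem eq_zero_of_forall_inner_tensorL_eq_zero [IsFiniteMeasure μ] [IsFiniteMeasure ν]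
    (e : X ≃ᵐ α × β) (he : MeasurePreserving e ρ (μ.prod ν)) (f : Lp ℝ 2 ρ)
    (hf : ∀ g h, ⟪f, tensorL he g h⟫_ℝ = 0) : f = 0 := by
  have : IsFiniteMeasure ρ := by
    refine ⟨?_⟩
    rw [← Set.preimage_univ (f := e), he.measure_preimage MeasurableSet.univ.nullMeasurableSet]
    exact measure_lt_top _ _
  have hfi : Integrable f ρ := (Lp.memLp f).integrable (by norm_num)
  have hrect : ∀ s t, MeasurableSet s → MeasurableSet t →
      ∫ x in e ⁻¹' (s ×ˢ t), f x ∂ρ = 0 := by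
    intro s t hs ht
    have := hf (indicatorConstLp 2 hs (measure_ne_top μ s) 1)
      (indicatorConstLp 2 ht (measure_ne_top ν t) 1)
    rw [L2.inner_def] at this
    rw [← this, ← integral_indicator (e.measurable (hs.prod ht))]
    refine integral_congr_ae ?_
    filter_upwards [coeFn_tensorL he (indicatorConstLp 2 hs (measure_ne_top μ s) (1 : ℝ))
      (indicatorConstLp 2 ht (measure_ne_top ν t) 1),
      ae_comp_fst he (indicatorConstLp_coeFn (p := 2) (hs := hs) (hμs := measure_ne_top μ s)
        (c := (1 : ℝ))),
      ae_comp_snd he (indicatorConstLp_coeFn (p := 2) (hs := ht) (hμs := measure_ne_top ν t)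
        (c := (1 : ℝ)))] with x h1 h2 h3
    rw [h1, h2, h3]
    by_cases hx1 : (e x).1 ∈ s <;> by_cases hx2 : (e x).2 ∈ t <;>
      simp [Set.indicator, hx1, hx2]
  have hall : ∀ s, MeasurableSet s → ∫ x in e ⁻¹' s, f x ∂ρ = 0 := by
    intro s hs
    induction s, hs using MeasurableSpace.induction_on_inter generateFrom_prod.symm
      isPiSystem_prod with
    | empty => simp
    | basic u hu =>
      obtain ⟨s, hs, t, ht, rfl⟩ := hu
      exact hrect s t hs ht
    | compl t ht ih =>
      have huniv := hrect Set.univ Set.univ MeasurableSet.univ MeasurableSet.univ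
      rw [Set.preimage_compl, setIntegral_compl (e.measurable ht) hfi, ih]
      simpa using huniv
    | iUnion g hd hm ih =>
      rw [Set.preimage_iUnion, integral_iUnion (fun i => e.measurable (hm i))
        (fun i j hij => (hd hij).preimage _) hfi.integrableOn]
      simp [ih]
  refine (Lp.eq_zero_iff_ae_eq_zero).2 (hfi.ae_eq_zero_of_forall_setIntegral_eq_zero ?_)
  intro s hs _
  have := hall (e.symm ⁻¹' s) (e.symm.measurable hs)
  rwa [← Set.preimage_comp, e.symm_comp_self, Set.preimage_id] at this

end TensorL2

/-! ### Weak gradients and test functions -/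

section SobolevBasics

theorem inner_gradient_right {E : Type*} [NormedAddCommGroup E] [InnerProductSpace ℝ E]
    [CompleteSpace E] (f : E → ℝ) (x e : E) : ⟪e, ∇ f x⟫_ℝ = fderiv ℝ f x e := by
  rw [real_inner_comm, gradient, InnerProductSpace.toDual_symm_apply]

variable {E : Type*} [NormedAddCommGroup E] [InnerProductSpace ℝ E] [FiniteDimensional ℝ E]
  [MeasurableSpace E] [BorelSpace E] {Ω : Opens E}

/-- The continuous linear map `u ↦ u` from `H¹(Ω)` to `L²(Ω)`. -/
def fnL (Ω : Opens E) : H1 Ω →L[ℝ] L2 Ω ℝ := (WithLp.fstL 2 ℝ _ _).comp (H1 Ω).subtypeL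

/-- The continuous linear map `u ↦ ∇u` from `H¹(Ω)` to `L²(Ω; E)`. -/
def gradL (Ω : Opens E) : H1 Ω →L[ℝ] L2 Ω E := (WithLp.sndL 2 ℝ _ _).comp (H1 Ω).subtypeL

theorem fnL_apply (u : H1 Ω) : fnL Ω u = H1.fn u := rfl

theorem H1.inner_def (u v : H1 Ω) :
    ⟪u, v⟫_ℝ = ⟪H1.fn u, H1.fn v⟫_ℝ + ⟪H1.grad u, H1.grad v⟫_ℝ := rfl

/-- The component of a vector field in the direction `e`. -/
def component (e : E) : L2 Ω E →L[ℝ] L2 Ω ℝ := (innerSL ℝ e).compLpL 2 _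

theorem coeFn_component (e : E) (g : L2 Ω E) :
    component e g =ᵐ[volume.restrict (Ω : Set E)] fun x => ⟪e, g x⟫_ℝ :=
  (innerSL ℝ e).coeFn_compLpL g

theorem inner_integral_smul {f : L2 Ω ℝ} {g : L2 Ω E} (e : E)
    (h : Integrable (fun x => f x • g x) (volume.restrict (Ω : Set E))) :
    ⟪e, ∫ x in (Ω : Set E), f x • g x⟫_ℝ = ⟪f, component e g⟫_ℝ := by
  rw [← integral_inner h, L2.inner_def]
  refine integral_congr_ae ?_
  filter_upwards [coeFn_component e g] with x hx
  simp [hx, real_inner_smul_right, mul_comm]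

theorem integrable_smul_L2 {G : Type*} [NormedAddCommGroup G] [NormedSpace ℝ G]
    (f : L2 Ω ℝ) (g : L2 Ω G) :
    Integrable (fun x => f x • g x) (volume.restrict (Ω : Set E)) :=
  memLp_one_iff_integrable.1 (MemLp.smul (p := 2) (q := 2) (r := 1) (Lp.memLp g) (Lp.memLp f))

/-- A test function as an element of `L²(Ω)`. -/
def testFn (φ : 𝓓(Ω, ℝ)) : L2 Ω ℝ :=
  (φ.continuous.memLp_of_hasCompactSupport φ.hasCompactSupport).toLp φ

/-- The classical gradient of a test function as an element of `L²(Ω; E)`. -/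
def testGrad (φ : 𝓓(Ω, ℝ)) : L2 Ω E :=
  ((continuous_gradient_testFunction φ).memLp_of_hasCompactSupport
    (hasCompactSupport_gradient_testFunction φ)).toLp _

theorem coeFn_testFn (φ : 𝓓(Ω, ℝ)) : testFn φ =ᵐ[volume.restrict (Ω : Set E)] φ :=
  MemLp.coeFn_toLp _

theorem coeFn_testGrad (φ : 𝓓(Ω, ℝ)) :
    testGrad φ =ᵐ[volume.restrict (Ω : Set E)] ∇ (φ : E → ℝ) :=
  MemLp.coeFn_toLp _

/-- The weak gradient expressed by inner products in `L²(Ω)`, one direction at a time. -/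
theorem isWeakGradient_iff {u : L2 Ω ℝ} {g : L2 Ω E} :
    IsWeakGradient Ω u g ↔ ∀ (φ : 𝓓(Ω, ℝ)) (e : E),
      ⟪u, component e (testGrad φ)⟫_ℝ = -⟪testFn φ, component e g⟫_ℝ := by
  refine forall_congr' fun φ => ?_
  have h1 : ∫ x in (Ω : Set E), u x • ∇ (φ : E → ℝ) x
      = ∫ x in (Ω : Set E), u x • testGrad φ x :=
    integral_congr_ae ((coeFn_testGrad φ).mono fun x hx => by simp only [hx])
  have h2 : ∫ x in (Ω : Set E), φ x • g x = ∫ x in (Ω : Set E), testFn φ x • g x :=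
    integral_congr_ae ((coeFn_testFn φ).mono fun x hx => by simp only [hx])
  rw [h1, h2]
  simp_rw [← inner_integral_smul _ (integrable_smul_L2 _ _)]
  constructor
  · intro h e
    rw [h, inner_neg_right]
  · intro h
    exact ext_inner_left ℝ fun e => by rw [h e, inner_neg_right]

theorem isWeakGradient_testFunction (φ : 𝓓(Ω, ℝ)) :
    IsWeakGradient Ω (testFn φ) (testGrad φ) := by
  intro ψ
  have h1 : ∫ x in (Ω : Set E), testFn φ x • ∇ (ψ : E → ℝ) x = ∫ x, φ x • ∇ (ψ : E → ℝ) x := by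
    rw [← setIntegral_eq_integral_of_forall_compl_eq_zero (s := (Ω : Set E))
      (f := fun x => φ x • ∇ (ψ : E → ℝ) x)]
    · exact integral_congr_ae ((coeFn_testFn φ).mono fun x hx => by simp only [hx])
    · intro x hx
      rw [image_eq_zero_of_notMem_tsupport fun h => hx (φ.tsupport_subset h), zero_smul]
  have h2 : ∫ x in (Ω : Set E), ψ x • testGrad φ x = ∫ x, ψ x • ∇ (φ : E → ℝ) x := by
    rw [← setIntegral_eq_integral_of_forall_compl_eq_zero (s := (Ω : Set E))
      (f := fun x => ψ x • ∇ (φ : E → ℝ) x)]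
    · exact integral_congr_ae ((coeFn_testGrad φ).mono fun x hx => by simp only [hx])
    · intro x hx
      rw [image_eq_zero_of_notMem_tsupport fun h => hx (ψ.tsupport_subset h), zero_smul]
  rw [h1, h2]
  have i1 : Integrable fun x => φ x • ∇ (ψ : E → ℝ) x :=
    (φ.continuous.smul (continuous_gradient_testFunction ψ)).integrable_of_hasCompactSupport
      φ.hasCompactSupport.smul_right
  have i2 : Integrable fun x => ψ x • ∇ (φ : E → ℝ) x :=
    (ψ.continuous.smul (continuous_gradient_testFunction φ)).integrable_of_hasCompactSupport
      ψ.hasCompactSupport.smul_right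
  refine ext_inner_left ℝ fun e => ?_
  rw [inner_neg_right, ← integral_inner i1, ← integral_inner i2]
  have j1 := i1.const_inner (𝕜 := ℝ) e
  have j2 := i2.const_inner (𝕜 := ℝ) e
  simp only [real_inner_smul_right, inner_gradient_right] at j1 j2 ⊢
  rw [integral_mul_fderiv_eq_neg_fderiv_mul_of_integrable (v := e)]
  · simp only [mul_comm]
  · simpa only [mul_comm] using j2
  · exact j1
  · exact (φ.continuous.mul ψ.continuous).integrable_of_hasCompactSupport
      φ.hasCompactSupport.mul_right
  · exact fun x _ => φ.contDiff.differentiable (by simp) x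
  · exact fun x _ => ψ.contDiff.differentiable (by simp) x

/-- A test function as an element of `H¹(Ω)`. -/
def testH1 (φ : 𝓓(Ω, ℝ)) : H1 Ω :=
  ⟨WithLp.toLp 2 (testFn φ, testGrad φ), isWeakGradient_testFunction φ⟩

theorem fn_testH1 (φ : 𝓓(Ω, ℝ)) : H1.fn (testH1 φ) = testFn φ := rfl

theorem grad_testH1 (φ : 𝓓(Ω, ℝ)) : H1.grad (testH1 φ) = testGrad φ := rfl

theorem testH1_mem_H10 (φ : 𝓓(Ω, ℝ)) : testH1 φ ∈ H10 Ω :=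
  Submodule.le_topologicalClosure _ ⟨φ, coeFn_testFn φ⟩

theorem inner_component_testGrad (u : H1 Ω) (φ : 𝓓(Ω, ℝ)) (e : E) :
    ⟪H1.fn u, component e (testGrad φ)⟫_ℝ = -⟪testFn φ, component e (H1.grad u)⟫_ℝ :=
  isWeakGradient_iff.1 u.2 φ e

theorem isClosed_H1 (Ω : Opens E) :
    IsClosed (H1 Ω : Set (WithLp 2 (L2 Ω ℝ × L2 Ω E))) := by
  have : (H1 Ω : Set (WithLp 2 (L2 Ω ℝ × L2 Ω E))) = ⋂ (φ : 𝓓(Ω, ℝ)) (e : E),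
      {U | ⟪U.fst, component e (testGrad φ)⟫_ℝ = -⟪testFn φ, component e U.snd⟫_ℝ} := by
    ext U
    simp only [Set.mem_iInter]
    exact isWeakGradient_iff
  rw [this]
  refine isClosed_iInter fun φ => isClosed_iInter fun e => isClosed_eq ?_ ?_
  · exact (WithLp.continuous_fst 2 _ _).inner continuous_const
  · exact (continuous_const.inner ((component e).continuous.comp (WithLp.continuous_snd 2 _ _))).neg

instance (Ω : Opens E) : CompleteSpace (H1 Ω) := (isClosed_H1 Ω).completeSpace_coe

/-- The fundamental lemma of the calculus of variations on an open subset `U` of `Ω`. -/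
theorem ae_eq_zero_of_forall_testFunction {G : Type*} [NormedAddCommGroup G] [NormedSpace ℝ G]
    [CompleteSpace G] (U : Opens E) (hU : U ≤ Ω) (f : L2 Ω G)
    (h : ∀ φ : 𝓓(Ω, ℝ), tsupport φ ⊆ U → ∫ x in (Ω : Set E), φ x • f x = 0) :
    ∀ᵐ x ∂(volume.restrict (Ω : Set E)), x ∈ U → f x = 0 := by
  refine U.isOpen.ae_eq_zero_of_integral_contDiff_smul_eq_zero ?_ fun g hg hgc hgU => ?_
  · exact ((Lp.memLp f).locallyIntegrable (by norm_num)).locallyIntegrableOn _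
  · exact h ⟨g, hg, hgc, hgU.trans hU⟩ hgU

theorem eq_zero_of_forall_inner_testFn {f : L2 Ω ℝ} (h : ∀ φ : 𝓓(Ω, ℝ), ⟪f, testFn φ⟫_ℝ = 0) :
    f = 0 := by
  have key : ∀ φ : 𝓓(Ω, ℝ), tsupport φ ⊆ Ω → ∫ x in (Ω : Set E), φ x • f x = 0 := by
    intro φ _
    rw [← h φ, L2.inner_def]
    exact integral_congr_ae ((coeFn_testFn φ).mono fun x hx => by simp [hx])
  refine Lp.eq_zero_iff_ae_eq_zero.2 ?_
  filter_upwards [ae_eq_zero_of_forall_testFunction Ω le_rfl f key,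
    ae_restrict_mem Ω.isOpen.measurableSet] with x hx hxΩ using hx hxΩ

/-- Where a Sobolev function vanishes on an open set, so does its weak gradient. -/
theorem ae_grad_eq_zero_of_ae_eq_zero (u : H1 Ω) (U : Opens E) (hU : U ≤ Ω)
    (hu : ∀ᵐ x ∂(volume.restrict (Ω : Set E)), x ∈ U → H1.fn u x = 0) :
    ∀ᵐ x ∂(volume.restrict (Ω : Set E)), x ∈ U → H1.grad u x = 0 := by
  refine ae_eq_zero_of_forall_testFunction U hU (H1.grad u) fun φ hφ => ?_
  have := u.2 φ
  rw [← neg_eq_zero]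
  refine this.symm.trans ?_
  rw [integral_congr_ae (g := fun _ => (0 : E)), integral_zero]
  filter_upwards [hu] with x hx
  by_cases hxU : x ∈ U
  · have : H1.fn u x = 0 := hx hxU
    rw [H1.fn] at this
    rw [this, zero_smul]
  · have : ∇ (φ : E → ℝ) x = 0 := by
      have h0 : fderiv ℝ φ x = 0 := image_eq_zero_of_notMem_tsupport fun h =>
        hxU (hφ (tsupport_fderiv_subset ℝ h))
      simp [gradient, h0]
    rw [this, smul_zero]

/-- An element of `H¹(Ω)` is determined by its underlying function: weak gradients are unique. -/
theorem H1.eq_of_fn_eq {u v : H1 Ω} (h : H1.fn u = H1.fn v) : u = v := by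
  have hw : H1.fn (u - v) = 0 := by
    rw [← fnL_apply, map_sub, fnL_apply, fnL_apply, h, sub_self]
  have hg : H1.grad (u - v) = 0 := by
    refine Lp.eq_zero_iff_ae_eq_zero.2 ?_
    filter_upwards [ae_grad_eq_zero_of_ae_eq_zero (u - v) Ω le_rfl
      ((Lp.eq_zero_iff_ae_eq_zero.1 hw).mono fun x hx _ => hx),
      ae_restrict_mem Ω.isOpen.measurableSet] with x hx hxΩ using hx hxΩ
  rw [← sub_eq_zero, ← inner_self_eq_zero (𝕜 := ℝ), H1.inner_def, hw, hg]
  simp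

/-- A closed condition on `H¹(Ω)` that holds for test functions holds on `H¹₀(Ω)`. -/
theorem H10_induction {p : H1 Ω → Prop} (hp : IsClosed {u | p u})
    (h : ∀ φ : 𝓓(Ω, ℝ), p (testH1 φ)) {u : H1 Ω} (hu : u ∈ H10 Ω) : p u := by
  refine hp.closure_subset_iff.2 ?_ hu
  rintro f ⟨φ, hφ⟩
  have : f = testH1 φ := H1.eq_of_fn_eq (Lp.ext (hφ.trans (coeFn_testFn φ).symm))
  exact this ▸ h φ

/-- Integration by parts between a function in `H¹(Ω)` and a function in `H¹₀(Ω)`. -/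
theorem inner_component_grad_of_mem_H10 (u : H1 Ω) {f : H1 Ω} (hf : f ∈ H10 Ω) (e : E) :
    ⟪H1.fn u, component e (H1.grad f)⟫_ℝ = -⟪H1.fn f, component e (H1.grad u)⟫_ℝ :=
  H10_induction (p := fun f => ⟪H1.fn u, component e (gradL Ω f)⟫_ℝ
      = -⟪fnL Ω f, component e (H1.grad u)⟫_ℝ)
    (isClosed_eq (continuous_const.inner ((component e).continuous.comp (gradL Ω).continuous))
      ((fnL Ω).continuous.inner continuous_const).neg)
    (fun φ => inner_component_testGrad u φ e) hf

end SobolevBasics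

/-! ### Compactly supported Sobolev functions -/

section Mollification

variable {E : Type*} [NormedAddCommGroup E] [InnerProductSpace ℝ E] [FiniteDimensional ℝ E]
  [MeasurableSpace E] [BorelSpace E]
  {G : Type*} [NormedAddCommGroup G] [InnerProductSpace ℝ G]

/-- The correlation of two square integrable functions is continuous, because translations act
continuously on `L²`. -/
theorem continuous_integral_inner_translate {k h : E → G} (hk : MemLp k 2 (volume : Measure E))
    (hh : MemLp h 2 (volume : Measure E)) :
    Continuous fun t : E => ∫ x, ⟪k x, h (t + x)⟫_ℝ := by
  have : Fact ((2 : ENNReal) ≠ ⊤) := ⟨by norm_num⟩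
  have hc : Continuous fun t : E => ⟪hk.toLp k, DomAddAct.mk t +ᵥ hh.toLp h⟫_ℝ :=
    continuous_const.inner ((DomAddAct.continuous_mk).vadd continuous_const)
  refine hc.congr fun t => ?_
  rw [DomAddAct.mk_vadd_toLp, L2.inner_def]
  refine integral_congr_ae ?_
  filter_upwards [hk.coeFn_toLp, MemLp.coeFn_toLp (hh.comp_measurePreserving
    (measurePreserving_vadd t (volume : Measure E)))] with x h1 h2
  rw [h1]
  exact congrArg (fun y => ⟪k x, y⟫_ℝ) h2

variable [CompleteSpace G]

/-- Mollification by a shrinking family of bump functions converges weakly in `L²`. -/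
theorem tendsto_integral_inner_mollify {k h : E → G} (hk : MemLp k 2 (volume : Measure E))
    (hh : MemLp h 2 (volume : Measure E)) (η : ℕ → ContDiffBump (0 : E))
    (hη : Filter.Tendsto (fun n => (η n).rOut) Filter.atTop (nhds 0)) :
    Filter.Tendsto (fun n => ∫ x, ⟪k x, convolution ((η n).normed volume) h
        (ContinuousLinearMap.lsmul ℝ ℝ) volume x⟫_ℝ)
      Filter.atTop (nhds (∫ x, ⟪k x, h x⟫_ℝ)) := by
  have hC := ContDiffBump.convolution_tendsto_right_of_continuous (μ := volume) hη
    (continuous_integral_inner_translate hk hh) 0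
  simp only [zero_add] at hC
  refine hC.congr fun n => ?_
  have hηi : Integrable ((η n).normed volume) := (η n).integrable_normed
  -- The integrand of the double integral is dominated by `η (|k|² + |h|²)`.
  have hint : Integrable (fun p : E × E => (η n).normed volume p.2 * ⟪k p.1, h (p.1 - p.2)⟫_ℝ)
      (volume.prod volume) := by
    have hm : AEStronglyMeasurable (fun p : E × E =>
        (η n).normed volume p.2 * ⟪k p.1, h (p.1 - p.2)⟫_ℝ) (volume.prod volume) :=
      hηi.1.comp_snd.mul (hk.1.comp_fst.inner (𝕜 := ℝ) (hh.1.comp_quasiMeasurePreserving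
        (quasiMeasurePreserving_sub_of_right_invariant volume volume)))
    have i1 : Integrable (fun p : E × E => ‖k p.1‖ ^ 2 * (η n).normed volume p.2)
      (volume.prod volume) := (hk.integrable_norm_pow (by norm_num)).mul_prod hηi
    have i2 : Integrable (fun p : E × E => (η n).normed volume p.2 * ‖h (p.1 - p.2)‖ ^ 2)
      (volume.prod volume) := hηi.convolution_integrand (ContinuousLinearMap.mul ℝ ℝ)
        (hh.integrable_norm_pow (by norm_num))
    refine (i1.add i2).mono' hm (Filter.Eventually.of_forall fun p => ?_)
    have h0 := (η n).nonneg_normed (μ := volume) p.2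
    have h1 := norm_inner_le_norm (𝕜 := ℝ) (k p.1) (h (p.1 - p.2))
    rw [norm_mul, Real.norm_of_nonneg h0]
    simp only [Pi.add_apply]
    nlinarith [two_mul_le_add_sq ‖k p.1‖ ‖h (p.1 - p.2)‖, norm_nonneg (k p.1),
      norm_nonneg (h (p.1 - p.2)), mul_nonneg (norm_nonneg (k p.1)) (norm_nonneg (h (p.1 - p.2)))]
  have hloc : LocallyIntegrable h (volume : Measure E) := hh.locallyIntegrable (by norm_num)
  have hpull : ∀ x, ⟪k x, convolution ((η n).normed volume) h
      (ContinuousLinearMap.lsmul ℝ ℝ) volume x⟫_ℝ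
        = ∫ t, (η n).normed volume t * ⟪k x, h (x - t)⟫_ℝ := by
    intro x
    have hci := ((η n).hasCompactSupport_normed (μ := volume)).convolutionExists_left
      (ContinuousLinearMap.lsmul ℝ ℝ) (η n).continuous_normed hloc x
    rw [convolution_def, ← integral_inner hci.integrable]
    simp [real_inner_smul_right]
  simp_rw [hpull]
  rw [integral_integral_swap hint, convolution_def]
  refine integral_congr_ae (Filter.Eventually.of_forall fun t => ?_)
  simp only [integral_const_mul, ContinuousLinearMap.lsmul_apply, smul_eq_mul]
  congr 2
  ext x
  rw [zero_sub, neg_add_eq_sub]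

variable {Ω : Opens E}

theorem tendsto_setIntegral_inner_mollify (k : L2 Ω G) {h : E → G}
    (hh : MemLp h 2 (volume : Measure E)) (η : ℕ → ContDiffBump (0 : E))
    (hη : Filter.Tendsto (fun n => (η n).rOut) Filter.atTop (nhds 0)) :
    Filter.Tendsto (fun n => ∫ x in (Ω : Set E), ⟪k x, convolution ((η n).normed volume) h
        (ContinuousLinearMap.lsmul ℝ ℝ) volume x⟫_ℝ)
      Filter.atTop (nhds (∫ x in (Ω : Set E), ⟪k x, h x⟫_ℝ)) := by
  have hk : MemLp ((Ω : Set E).indicator k) 2 (volume : Measure E) :=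
    (memLp_indicator_iff_restrict Ω.isOpen.measurableSet).2 (Lp.memLp k)
  have e : ∀ H : E → G, ∫ x, ⟪(Ω : Set E).indicator k x, H x⟫_ℝ
      = ∫ x in (Ω : Set E), ⟪k x, H x⟫_ℝ := by
    intro H
    rw [← integral_indicator Ω.isOpen.measurableSet]
    congr 1
    ext x
    by_cases hx : x ∈ (Ω : Set E) <;> simp [hx]
  simpa only [e] using tendsto_integral_inner_mollify hk hh η hη

/-- A Sobolev function supported in a compact subset of `Ω` may be integrated by parts against
smooth functions that do not vanish near the boundary. -/
theorem integral_smul_gradient_of_ae_eq_zero (u : H1 Ω) {K : Set E} (hK : IsCompact K)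
    (hKΩ : K ⊆ Ω) (hu : ∀ᵐ x ∂(volume.restrict (Ω : Set E)), x ∉ K → H1.fn u x = 0)
    (hg : ∀ᵐ x ∂(volume.restrict (Ω : Set E)), x ∉ K → H1.grad u x = 0)
    {ψ : E → ℝ} (hψ : ContDiff ℝ ((⊤ : ℕ∞) : WithTop ℕ∞) ψ) :
    ∫ x in (Ω : Set E), H1.fn u x • ∇ ψ x = - ∫ x in (Ω : Set E), ψ x • H1.grad u x := by
  -- A cutoff function `ζ` turns `ψ` into a test function without changing it near `K`.
  obtain ⟨K', hK', hKK', hK'Ω⟩ := exists_compact_between hK Ω.isOpen hKΩ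
  obtain ⟨ζ, hζ1, hζ0, -⟩ := exists_contMDiffMap_one_nhds_of_subset_interior (n := (⊤ : ℕ∞))
    (modelWithCornersSelf ℝ E) hK.isClosed hKK'
  have hζ : ContDiff ℝ ((⊤ : ℕ∞) : WithTop ℕ∞) ζ := ζ.contMDiff.contDiff
  have hsupp : tsupport ζ ⊆ K' := closure_minimal
    (fun x hx => by_contra fun h => hx (hζ0 x h)) hK'.isClosed
  have hcs : HasCompactSupport ζ := hK'.of_isClosed_subset (isClosed_tsupport _) hsupp
  let φ : 𝓓(Ω, ℝ) := ⟨ζ * ψ, hζ.mul hψ, hcs.mul_right,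
    (tsupport_mul_subset_left (f := ζ) (g := ψ)).trans (hsupp.trans hK'Ω)⟩
  have hφ : ∀ x ∈ K, (φ : E → ℝ) =ᶠ[nhds x] ψ := by
    intro x hx
    filter_upwards [hζ1.filter_mono (nhds_le_nhdsSet hx)] with y hy
    change ζ y * ψ y = ψ y
    rw [hy, one_mul]
  have h := u.2 φ
  have e1 : ∫ x in (Ω : Set E), H1.fn u x • ∇ ψ x
      = ∫ x in (Ω : Set E), H1.fn u x • ∇ (φ : E → ℝ) x := by
    refine integral_congr_ae ?_
    filter_upwards [hu] with x hx
    by_cases hxK : x ∈ K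
    · rw [gradient, gradient, (hφ x hxK).fderiv_eq]
    · rw [hx hxK, zero_smul, zero_smul]
  have e2 : ∫ x in (Ω : Set E), ψ x • H1.grad u x
      = ∫ x in (Ω : Set E), φ x • H1.grad u x := by
    refine integral_congr_ae ?_
    filter_upwards [hg] with x hx
    by_cases hxK : x ∈ K
    · rw [(hφ x hxK).eq_of_nhds]
    · rw [hx hxK, smul_zero, smul_zero]
  rw [e1, e2]
  exact h

/-- A Sobolev function that vanishes almost everywhere outside a compact subset of `Ω` belongs to
`H¹₀(Ω)`: it is the weak limit of its mollifications, so it is orthogonal to everything that is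
orthogonal to the test functions. -/
theorem mem_H10_of_ae_eq_zero (u : H1 Ω) {K : Set E} (hK : IsCompact K) (hKΩ : K ⊆ Ω)
    (hu : ∀ᵐ x ∂(volume.restrict (Ω : Set E)), x ∉ K → H1.fn u x = 0) : u ∈ H10 Ω := by
  have hg : ∀ᵐ x ∂(volume.restrict (Ω : Set E)), x ∉ K → H1.grad u x = 0 := by
    let U : Opens E := ⟨(Ω : Set E) \ K, Ω.isOpen.sdiff hK.isClosed⟩
    filter_upwards [ae_grad_eq_zero_of_ae_eq_zero u U Set.sdiff_subset
      (hu.mono fun x hx hxU => hx hxU.2), ae_restrict_mem Ω.isOpen.measurableSet] with x hx hxΩ hxK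
    exact hx ⟨hxΩ, hxK⟩
  -- The extensions of `u` and its gradient by zero outside `K`.
  set u₀ : E → ℝ := K.indicator (H1.fn u) with hu₀
  set g₀ : E → E := K.indicator (H1.grad u) with hg₀
  have hres : (volume.restrict (Ω : Set E)).restrict K = (volume : Measure E).restrict K := by
    rw [Measure.restrict_restrict hK.measurableSet, Set.inter_eq_left.2 hKΩ]
  have hu₀L : MemLp u₀ 2 (volume : Measure E) := by
    rw [hu₀, memLp_indicator_iff_restrict hK.measurableSet, ← hres]
    exact (Lp.memLp (H1.fn u)).restrict K
  have hg₀L : MemLp g₀ 2 (volume : Measure E) := by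
    rw [hg₀, memLp_indicator_iff_restrict hK.measurableSet, ← hres]
    exact (Lp.memLp (H1.grad u)).restrict K
  have hu₀e : u₀ =ᵐ[volume.restrict (Ω : Set E)] H1.fn u := by
    filter_upwards [hu] with x hx
    by_cases hxK : x ∈ K
    · simp [hu₀, hxK]
    · simp [hu₀, hxK, hx hxK]
  have hg₀e : g₀ =ᵐ[volume.restrict (Ω : Set E)] H1.grad u := by
    filter_upwards [hg] with x hx
    by_cases hxK : x ∈ K
    · simp [hg₀, hxK]
    · simp [hg₀, hxK, hx hxK]
  have hu₀l : LocallyIntegrable u₀ (volume : Measure E) := hu₀L.locallyIntegrable (by norm_num)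
  have hg₀l : LocallyIntegrable g₀ (volume : Measure E) := hg₀L.locallyIntegrable (by norm_num)
  obtain ⟨δ, hδ, hδΩ⟩ := hK.exists_cthickening_subset_open Ω.isOpen hKΩ
  obtain ⟨r, -, hr0, hr⟩ := exists_seq_strictAnti_tendsto' hδ
  let η : ℕ → ContDiffBump (0 : E) := fun n =>
    ⟨r n / 2, r n, half_pos (hr0 n).1, half_lt_self (hr0 n).1⟩
  have hη : Filter.Tendsto (fun n => (η n).rOut) Filter.atTop (nhds 0) := hr
  -- The mollifications are test functions whose gradients are the mollified gradients.
  have hmoll : ∀ n, ∃ φ : 𝓓(Ω, ℝ),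
      (∀ x, φ x = convolution ((η n).normed volume) u₀ (ContinuousLinearMap.lsmul ℝ ℝ) volume x) ∧
      ∀ x, ∇ (φ : E → ℝ) x
        = convolution ((η n).normed volume) g₀ (ContinuousLinearMap.lsmul ℝ ℝ) volume x := by
    intro n
    set U : E → ℝ :=
      convolution ((η n).normed volume) u₀ (ContinuousLinearMap.lsmul ℝ ℝ) volume with hU
    have hUs : Function.support U ⊆ Metric.cthickening δ K := by
      intro x hx
      obtain ⟨a, ha, b, hb, rfl⟩ := support_convolution_subset _ hx
      rw [ContDiffBump.support_normed_eq] at ha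
      have hbK : b ∈ K := by
        by_contra h
        exact hb (Set.indicator_of_notMem h _)
      refine Metric.mem_cthickening_of_dist_le _ b δ K hbK ?_
      rw [dist_eq_norm, add_sub_cancel_right, ← dist_zero_right]
      exact (Metric.mem_ball.1 ha).le.trans (hr0 n).2.le
    have hUc : ContDiff ℝ ((⊤ : ℕ∞) : WithTop ℕ∞) U :=
      (η n).hasCompactSupport_normed.contDiff_convolution_left _ (η n).contDiff_normed hu₀l
    have hUt : tsupport U ⊆ Metric.cthickening δ K :=
      closure_minimal hUs Metric.isClosed_cthickening
    refine ⟨⟨U, hUc, hK.cthickening.of_isClosed_subset (isClosed_tsupport _) hUt,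
      hUt.trans hδΩ⟩, fun x => rfl, fun x => ?_⟩
    change ∇ U x = _
    have hηs : ContDiff ℝ ((⊤ : ℕ∞) : WithTop ℕ∞) ((η n).normed volume) := (η n).contDiff_normed
    set ψ : E → ℝ := fun s => (η n).normed volume (x - s) with hψ
    have hψs : ContDiff ℝ ((⊤ : ℕ∞) : WithTop ℕ∞) ψ := hηs.comp (contDiff_const.sub contDiff_id)
    have hψg : ∀ s e, ⟪e, ∇ ψ s⟫_ℝ = - fderiv ℝ ((η n).normed volume) (x - s) e := by
      intro s e
      have hd := (hηs.differentiable (by simp) (x - s)).hasFDerivAt.comp s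
        ((hasFDerivAt_id s).const_sub x)
      have hd' : fderiv ℝ ψ s = _ := hd.fderiv
      rw [inner_gradient_right, hd']
      simp
    have hibp := integral_smul_gradient_of_ae_eq_zero u hK hKΩ hu hg hψs
    have hR : convolution ((η n).normed volume) g₀ (ContinuousLinearMap.lsmul ℝ ℝ) volume x
        = ∫ s in (Ω : Set E), ψ s • H1.grad u s := by
      rw [convolution_lsmul_swap, ← setIntegral_eq_integral_of_forall_compl_eq_zero
        (s := (Ω : Set E))]
      · exact integral_congr_ae (hg₀e.mono fun s hs => by simp only [hs, hψ])
      · intro s hs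
        rw [hg₀, Set.indicator_of_notMem fun h => hs (hKΩ h), smul_zero]
    rw [hR, ← neg_eq_iff_eq_neg.2 hibp]
    have hψc : HasCompactSupport ψ :=
      ((η n).hasCompactSupport_normed (μ := volume)).comp_homeomorph (Homeomorph.subLeft x)
    have hint : Integrable (fun s => H1.fn u s • ∇ ψ s) (volume.restrict (Ω : Set E)) :=
      memLp_one_iff_integrable.1 (MemLp.smul (p := 2) (q := 2) (r := 1)
        (((InnerProductSpace.toDual ℝ E).symm.continuous.comp
          (hψs.continuous_fderiv (by simp))).memLp_of_hasCompactSupport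
          ((hψc.fderiv ℝ).comp_left (g := (InnerProductSpace.toDual ℝ E).symm) (map_zero _)))
        (Lp.memLp (H1.fn u)))
    have hUR : U = convolution u₀ ((η n).normed volume) (ContinuousLinearMap.mul ℝ ℝ) volume := by
      ext y
      rw [hU, convolution_lsmul_swap, convolution_mul]
      simp only [smul_eq_mul, mul_comm]
    refine ext_inner_left ℝ fun e => ?_
    rw [inner_neg_right, ← integral_inner hint, inner_gradient_right, hUR,
      (((η n).hasCompactSupport_normed (μ := volume)).hasFDerivAt_convolution_right
        (ContinuousLinearMap.mul ℝ ℝ) hu₀l (hηs.of_le (by simp)) x).fderiv,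
      convolution_precompR_apply _ hu₀l (((η n).hasCompactSupport_normed).fderiv ℝ)
        (hηs.continuous_fderiv (by simp)), convolution_mul, ← integral_neg,
      ← setIntegral_eq_integral_of_forall_compl_eq_zero (s := (Ω : Set E))]
    · refine integral_congr_ae ?_
      filter_upwards [hu₀e] with s hs
      rw [hs, real_inner_smul_right, hψg, mul_neg, neg_neg]
    · intro s hs
      rw [hu₀, Set.indicator_of_notMem fun h => hs (hKΩ h), zero_mul]
  choose φ hφ hφg using hmoll
  rw [H10, ← Submodule.orthogonal_orthogonal_eq_closure]
  intro f hf
  have hf0 : ∀ n, ⟪f, testH1 (φ n)⟫_ℝ = 0 := by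
    intro n
    rw [real_inner_comm]
    exact hf _ ⟨φ n, coeFn_testFn _⟩
  -- The inner product of `f` with the mollifications is zero and converges to that with `u`.
  have hlim := (tendsto_setIntegral_inner_mollify (H1.fn f) hu₀L η hη).add
    (tendsto_setIntegral_inner_mollify (H1.grad f) hg₀L η hη)
  have hval : ∀ n, (∫ x in (Ω : Set E), ⟪H1.fn f x, convolution ((η n).normed volume) u₀
        (ContinuousLinearMap.lsmul ℝ ℝ) volume x⟫_ℝ)
      + (∫ x in (Ω : Set E), ⟪H1.grad f x, convolution ((η n).normed volume) g₀
        (ContinuousLinearMap.lsmul ℝ ℝ) volume x⟫_ℝ) = 0 := by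
    intro n
    rw [← hf0 n, H1.inner_def, L2.inner_def, L2.inner_def]
    congr 1
    · refine integral_congr_ae ?_
      filter_upwards [coeFn_testFn (φ n)] with x hx
      rw [fn_testH1, hx, hφ]
    · refine integral_congr_ae ?_
      filter_upwards [coeFn_testGrad (φ n)] with x hx
      rw [grad_testH1, hx, hφg]
  simp only [hval] at hlim
  rw [H1.inner_def, L2.inner_def, L2.inner_def, tendsto_nhds_unique tendsto_const_nhds hlim]
  congr 1
  · exact integral_congr_ae (hu₀e.mono fun x hx => by simp only [hx])
  · exact integral_congr_ae (hg₀e.mono fun x hx => by simp only [hx])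

end Mollification

/-! ### Product coordinates -/

section Chart

set_option linter.unusedSectionVars false

variable {E : Type*} [NormedAddCommGroup E] [InnerProductSpace ℝ E] [FiniteDimensional ℝ E]
  [MeasurableSpace E] [BorelSpace E]
  {F : Type*} [NormedAddCommGroup F] [InnerProductSpace ℝ F] [FiniteDimensional ℝ F]
  [MeasurableSpace F] [BorelSpace F]
  {X : Type*} [NormedAddCommGroup X] [InnerProductSpace ℝ X] [FiniteDimensional ℝ X]
  [MeasurableSpace X] [BorelSpace X]
  {D : Opens X} {Y : Opens E} {Z : Opens F}

/-- An identification of the open set `D` with the product `Y × Z` by a linear isometry of the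
ambient space `X` with the Euclidean product. Both orders of the factors are used, and `swap`
exchanges them. -/
structure ProductChart (D : Opens X) (Y : Opens E) (Z : Opens F) where
  /-- The linear isometry of the ambient spaces. -/
  toIso : X ≃ₗᵢ[ℝ] WithLp 2 (E × F)
  mem_iff : ∀ x, x ∈ D ↔ (toIso x).fst ∈ Y ∧ (toIso x).snd ∈ Z

namespace ProductChart

/-- The product domain in its own coordinates. -/
def refl (Y : Opens E) (Z : Opens F) : ProductChart (prodDomain Y Z) Y Z where
  toIso := LinearIsometryEquiv.refl ℝ _
  mem_iff _ := Iff.rfl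

variable (c : ProductChart D Y Z)

/-- The chart with the two factors exchanged. -/
def swap : ProductChart D Z Y where
  toIso := c.toIso.trans
    { toLinearEquiv := (WithLp.linearEquiv 2 ℝ (E × F)).trans
        ((LinearEquiv.prodComm ℝ E F).trans (WithLp.linearEquiv 2 ℝ (F × E)).symm)
      norm_map' := fun x => by
        rw [WithLp.prod_norm_eq_of_L2, WithLp.prod_norm_eq_of_L2, add_comm]
        rfl }
  mem_iff x := (c.mem_iff x).trans And.comm

/-- The first coordinate. -/
def fst : X →L[ℝ] E := (WithLp.fstL 2 ℝ E F).comp (c.toIso : X →L[ℝ] WithLp 2 (E × F))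

/-- The second coordinate. -/
def snd : X →L[ℝ] F := (WithLp.sndL 2 ℝ E F).comp (c.toIso : X →L[ℝ] WithLp 2 (E × F))

/-- The inclusion of the first factor, defined as the adjoint of the first coordinate. -/
def inl : E →L[ℝ] X := c.fst.adjoint

/-- The inclusion of the second factor, defined as the adjoint of the second coordinate. -/
def inr : F →L[ℝ] X := c.snd.adjoint

theorem swap_fst : c.swap.fst = c.snd := rfl

theorem swap_snd : c.swap.snd = c.fst := rfl

theorem swap_inl : c.swap.inl = c.inr := rfl

theorem inner_eq (x x' : X) :
    ⟪x, x'⟫_ℝ = ⟪c.fst x, c.fst x'⟫_ℝ + ⟪c.snd x, c.snd x'⟫_ℝ := by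
  rw [← c.toIso.inner_map_map, WithLp.prod_inner_apply]
  rfl

theorem inner_inl (e : E) (x : X) : ⟪c.inl e, x⟫_ℝ = ⟪e, c.fst x⟫_ℝ :=
  ContinuousLinearMap.adjoint_inner_left _ _ _

theorem fst_inl (e : E) : c.fst (c.inl e) = e := by
  have h : c.inl e = c.toIso.symm (WithLp.toLp 2 (e, 0)) := by
    refine ext_inner_right ℝ fun x => ?_
    rw [c.inner_inl, ← c.toIso.inner_map_map, c.toIso.apply_symm_apply, WithLp.prod_inner_apply]
    simp [fst]
  rw [h]
  simp [fst]

theorem snd_inl (e : E) : c.snd (c.inl e) = 0 := by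
  have h := c.inner_eq (c.inl e) (c.inl e)
  rw [c.inner_inl, fst_inl] at h
  exact inner_self_eq_zero.1 (by linarith : ⟪c.snd (c.inl e), c.snd (c.inl e)⟫_ℝ = 0)

theorem inl_fst_add_inr_snd (x : X) : c.inl (c.fst x) + c.inr (c.snd x) = x := by
  refine ext_inner_right ℝ fun x' => ?_
  rw [inner_add_left, c.inner_inl, ← c.swap_inl, c.swap.inner_inl, swap_fst, c.inner_eq x x']

/-- The identification of the ambient space with the product as a homeomorphism. -/
def homeo : X ≃ₜ E × F :=
  c.toIso.toHomeomorph.trans (WithLp.homeomorphProd 2 E F)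

theorem mem_iff' (x : X) : x ∈ D ↔ c.fst x ∈ Y ∧ c.snd x ∈ Z := c.mem_iff x

/-- The identification of the ambient space with the product as a measurable equivalence. -/
def measEquiv : X ≃ᵐ E × F := c.homeo.toMeasurableEquiv

theorem measurePreserving : MeasurePreserving c.measEquiv (volume.restrict (D : Set X))
    ((volume.restrict (Y : Set E)).prod (volume.restrict (Z : Set F))) := by
  have h : MeasurePreserving c.measEquiv (volume : Measure X) (volume : Measure (E × F)) :=
    (WithLp.volume_preserving_ofLp E F).comp c.toIso.measurePreserving
  have hD : (D : Set X) = c.measEquiv ⁻¹' ((Y : Set E) ×ˢ (Z : Set F)) := by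
    ext x
    exact c.mem_iff x
  rw [Measure.prod_restrict, hD]
  exact h.restrict_preimage (Y.isOpen.prod Z.isOpen).measurableSet

end ProductChart
end Chart

/-! ### Tensor products and partial integrals of Sobolev functions -/

section FieldMaps

variable {E : Type*} [NormedAddCommGroup E] [InnerProductSpace ℝ E] [FiniteDimensional ℝ E]
  [MeasurableSpace E] [BorelSpace E]
  {α : Type*} [MeasurableSpace α] {μ : Measure α}

theorem inner_compLpL_left {G G' : Type*} [NormedAddCommGroup G] [InnerProductSpace ℝ G]
    [CompleteSpace G] [NormedAddCommGroup G'] [InnerProductSpace ℝ G'] [CompleteSpace G']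
    (A : G →L[ℝ] G') (u : Lp G 2 μ) (w : Lp G' 2 μ) :
    ⟪A.compLpL 2 μ u, w⟫_ℝ = ⟪u, A.adjoint.compLpL 2 μ w⟫_ℝ := by
  rw [L2.inner_def, L2.inner_def]
  refine integral_congr_ae ?_
  filter_upwards [A.coeFn_compLpL u, A.adjoint.coeFn_compLpL w] with x h1 h2
  rw [h1, h2, ContinuousLinearMap.adjoint_inner_right]

theorem component_add {Ω : Opens E} (e e' : E) (g : L2 Ω E) :
    component (e + e') g = component e g + component e' g := by
  refine Lp.ext ?_
  filter_upwards [coeFn_component (e + e') g, coeFn_component e g, coeFn_component e' g,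
    Lp.coeFn_add (component e g) (component e' g)] with x h1 h2 h3 h4
  rw [h1, h4, Pi.add_apply, h2, h3, inner_add_left]

end FieldMaps

section ChartOperators

set_option linter.unusedSectionVars false

variable {E : Type*} [NormedAddCommGroup E] [InnerProductSpace ℝ E] [FiniteDimensional ℝ E]
  [MeasurableSpace E] [BorelSpace E]
  {F : Type*} [NormedAddCommGroup F] [InnerProductSpace ℝ F] [FiniteDimensional ℝ F]
  [MeasurableSpace F] [BorelSpace F]
  {X : Type*} [NormedAddCommGroup X] [InnerProductSpace ℝ X] [FiniteDimensional ℝ X]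
  [MeasurableSpace X] [BorelSpace X]
  {D : Opens X} {Y : Opens E} {Z : Opens F}
  {G : Type*} [NormedAddCommGroup G] [InnerProductSpace ℝ G]
  {G' : Type*} [NormedAddCommGroup G'] [InnerProductSpace ℝ G']

namespace ProductChart

variable (c : ProductChart D Y Z)

/-- The tensor product `(g ⊗ h)(y, z) = h(z) g(y)` of `g ∈ L²(Y; G)` and `h ∈ L²(Z)`. -/
def tensor : L2 Y G →L[ℝ] L2 Z ℝ →L[ℝ] L2 D G := tensorL c.measurePreserving

theorem coeFn_tensor (g : L2 Y G) (h : L2 Z ℝ) :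
    c.tensor g h =ᵐ[volume.restrict (D : Set X)] fun x => h (c.snd x) • g (c.fst x) :=
  coeFn_tensorL _ g h

theorem ae_fst {p : E → Prop} (hp : ∀ᵐ y ∂(volume.restrict (Y : Set E)), p y) :
    ∀ᵐ x ∂(volume.restrict (D : Set X)), p (c.fst x) :=
  ae_comp_fst c.measurePreserving hp

theorem ae_snd {p : F → Prop} (hp : ∀ᵐ z ∂(volume.restrict (Z : Set F)), p z) :
    ∀ᵐ x ∂(volume.restrict (D : Set X)), p (c.snd x) :=
  ae_comp_snd c.measurePreserving hp

theorem inner_tensor (g g' : L2 Y G) (h h' : L2 Z ℝ) :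
    ⟪c.tensor g h, c.tensor g' h'⟫_ℝ = ⟪g, g'⟫_ℝ * ⟪h, h'⟫_ℝ :=
  inner_tensorL _ g g' h h'

theorem compLpL_tensor (A : G →L[ℝ] G') (g : L2 Y G) (h : L2 Z ℝ) :
    A.compLpL 2 _ (c.tensor g h) = c.tensor (A.compLpL 2 _ g) h :=
  compLpL_tensorL _ A g h

theorem component_tensor (e : E) (g : L2 Y E) (h : L2 Z ℝ) :
    (innerSL ℝ e).compLpL 2 _ (c.tensor g h) = c.tensor (component e g) h :=
  compLpL_tensorL _ _ g h

theorem swap_tensor (g : L2 Y ℝ) (h : L2 Z ℝ) : c.swap.tensor h g = c.tensor g h :=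
  tensorL_swap c.measurePreserving c.swap.measurePreserving g h

/-- The first part of a vector field on `D`. -/
def fstField : L2 D X →L[ℝ] L2 D E := c.fst.compLpL 2 _

/-- A field of vectors of the first factor as a vector field on `D`. -/
def inlField : L2 D E →L[ℝ] L2 D X := c.inl.compLpL 2 _

theorem inner_inlField (A : L2 D E) (B : L2 D X) :
    ⟪c.inlField A, B⟫_ℝ = ⟪A, c.fstField B⟫_ℝ := by
  rw [inlField, inner_compLpL_left, inl, ContinuousLinearMap.adjoint_adjoint, fstField]

theorem component_fstField (e : E) (B : L2 D X) :
    (innerSL ℝ e).compLpL 2 _ (c.fstField B) = component (c.inl e) B := by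
  refine Lp.ext ?_
  filter_upwards [(innerSL ℝ e).coeFn_compLpL (c.fstField B), coeFn_component (c.inl e) B,
    c.fst.coeFn_compLpL B] with x h1 h2 h3
  rw [h1, h2, fstField, h3, c.inner_inl]
  rfl

theorem component_inlField (x : X) (A : L2 D E) :
    component x (c.inlField A) = (innerSL ℝ (c.fst x)).compLpL 2 _ A := by
  refine Lp.ext ?_
  filter_upwards [(innerSL ℝ (c.fst x)).coeFn_compLpL A, coeFn_component x (c.inlField A),
    c.inl.coeFn_compLpL A] with x' h1 h2 h3
  rw [h1, h2, inlField, h3, real_inner_comm, c.inner_inl, real_inner_comm]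
  rfl

/-- The product `ψ(y) χ(z)` of test functions as a test function on `D`. -/
def testProd (ψ : 𝓓(Y, ℝ)) (χ : 𝓓(Z, ℝ)) : 𝓓(D, ℝ) where
  toFun x := ψ (c.fst x) * χ (c.snd x)
  contDiff' := (ψ.contDiff.comp c.fst.contDiff).mul (χ.contDiff.comp c.snd.contDiff)
  hasCompactSupport' := by
    refine HasCompactSupport.intro (K := c.homeo ⁻¹' (tsupport ψ ×ˢ tsupport χ))
      ((c.homeo.isCompact_preimage).2 (ψ.hasCompactSupport.isCompact.prod
        χ.hasCompactSupport.isCompact)) fun x hx => ?_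
    by_contra h
    exact hx ⟨subset_tsupport _ (left_ne_zero_of_mul h), subset_tsupport _ (right_ne_zero_of_mul h)⟩
  tsupport_subset' := by
    have hsub : tsupport (fun x => ψ (c.fst x) * χ (c.snd x))
        ⊆ c.homeo ⁻¹' (tsupport ψ ×ˢ tsupport χ) :=
      closure_minimal (fun x hx => ⟨subset_tsupport _ (left_ne_zero_of_mul hx),
        subset_tsupport _ (right_ne_zero_of_mul hx)⟩)
        (((isClosed_tsupport _).prod (isClosed_tsupport _)).preimage c.homeo.continuous)
    exact fun x hx => (c.mem_iff' x).2
      ⟨ψ.tsupport_subset (hsub hx).1, χ.tsupport_subset (hsub hx).2⟩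

theorem testProd_apply (ψ : 𝓓(Y, ℝ)) (χ : 𝓓(Z, ℝ)) (x : X) :
    c.testProd ψ χ x = ψ (c.fst x) * χ (c.snd x) := rfl

theorem testFn_testProd (ψ : 𝓓(Y, ℝ)) (χ : 𝓓(Z, ℝ)) :
    testFn (c.testProd ψ χ) = c.tensor (testFn ψ) (testFn χ) := by
  refine Lp.ext ?_
  filter_upwards [coeFn_testFn (c.testProd ψ χ), c.coeFn_tensor (testFn ψ) (testFn χ),
    c.ae_fst (coeFn_testFn ψ), c.ae_snd (coeFn_testFn χ)] with x h1 h2 h3 h4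
  rw [h1, h2, h3, h4, testProd_apply, smul_eq_mul, mul_comm]

theorem component_testGrad_testProd (ψ : 𝓓(Y, ℝ)) (χ : 𝓓(Z, ℝ)) (e : E) :
    component (c.inl e) (testGrad (c.testProd ψ χ))
      = c.tensor (component e (testGrad ψ)) (testFn χ) := by
  refine Lp.ext ?_
  filter_upwards [coeFn_testGrad (c.testProd ψ χ),
    coeFn_component (c.inl e) (testGrad (c.testProd ψ χ)),
    c.coeFn_tensor (component e (testGrad ψ)) (testFn χ),
    c.ae_fst (coeFn_component e (testGrad ψ)), c.ae_fst (coeFn_testGrad ψ),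
    c.ae_snd (coeFn_testFn χ)] with x h1 h2 h3 h4 h5 h6
  rw [h2, h1, h3, h4, h5, h6, inner_gradient_right, inner_gradient_right]
  have d1 := (ψ.contDiff.differentiable (by simp) (c.fst x)).hasFDerivAt.comp x c.fst.hasFDerivAt
  have d2 := (χ.contDiff.differentiable (by simp) (c.snd x)).hasFDerivAt.comp x c.snd.hasFDerivAt
  have d : fderiv ℝ (c.testProd ψ χ) x = _ := (d1.mul d2).fderiv
  rw [d]
  simp [c.fst_inl, c.snd_inl]

section Partial

variable [CompleteSpace G] [CompleteSpace G']

/-- The partial integral `y ↦ ∫ h(z) f(y, z) dz` of `f ∈ L²(D; G)` against `h ∈ L²(Z)`, defined as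
the adjoint of the tensor product with `h`. -/
def partialInt (h : L2 Z ℝ) : L2 D G →L[ℝ] L2 Y G := (c.tensor.flip h).adjoint

theorem inner_partialInt (h : L2 Z ℝ) (f : L2 D G) (g : L2 Y G) :
    ⟪c.partialInt h f, g⟫_ℝ = ⟪f, c.tensor g h⟫_ℝ :=
  ContinuousLinearMap.adjoint_inner_left _ _ _

theorem inner_partialInt_right (h : L2 Z ℝ) (f : L2 D G) (g : L2 Y G) :
    ⟪g, c.partialInt h f⟫_ℝ = ⟪c.tensor g h, f⟫_ℝ :=
  ContinuousLinearMap.adjoint_inner_right _ _ _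

theorem compLpL_partialInt (A : G →L[ℝ] G') (h : L2 Z ℝ) (f : L2 D G) :
    A.compLpL 2 _ (c.partialInt h f) = c.partialInt h (A.compLpL 2 _ f) := by
  refine ext_inner_right ℝ fun k => ?_
  rw [inner_compLpL_left, inner_partialInt, inner_partialInt, inner_compLpL_left, compLpL_tensor]

end Partial

/-- Partial integration of a Sobolev function commutes with differentiation in the remaining
variable. For test functions `h` this is the definition of the weak gradient, tested against
products; the general case follows by density of the test functions in `L²(Z)`. -/
theorem isWeakGradient_partialInt (h : L2 Z ℝ) (f : H1 D) :
    IsWeakGradient Y (c.partialInt h (H1.fn f)) (c.partialInt h (c.fstField (H1.grad f))) := by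
  refine isWeakGradient_iff.2 fun ψ e => ?_
  have hcomp : component e (c.partialInt h (c.fstField (H1.grad f)))
      = c.partialInt h (component (c.inl e) (H1.grad f)) := by
    rw [component, compLpL_partialInt, component_fstField]
  rw [inner_partialInt, hcomp, inner_partialInt_right]
  -- The claim is that `h` is orthogonal to `z`, and `z` is orthogonal to all test functions.
  set z : L2 Z ℝ := (c.tensor (component e (testGrad ψ))).adjoint (H1.fn f)
    + (c.tensor (testFn ψ)).adjoint (component (c.inl e) (H1.grad f)) with hz
  have hzi : ∀ k, ⟪z, k⟫_ℝ = ⟪H1.fn f, c.tensor (component e (testGrad ψ)) k⟫_ℝ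
      + ⟪component (c.inl e) (H1.grad f), c.tensor (testFn ψ) k⟫_ℝ := by
    intro k
    rw [hz, inner_add_left, ContinuousLinearMap.adjoint_inner_left,
      ContinuousLinearMap.adjoint_inner_left]
  have hz0 : z = 0 := by
    refine eq_zero_of_forall_inner_testFn fun χ => ?_
    rw [hzi, ← component_testGrad_testProd, ← testFn_testProd, inner_component_testGrad,
      real_inner_comm, neg_add_cancel]
  have := hzi h
  rw [hz0, inner_zero_left, real_inner_comm (c.tensor (testFn ψ) h)] at this
  linarith

/-- Partial integration against `h ∈ L²(Z)` as a map from `H¹(D)` to `H¹(Y)`. -/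
def partialH1 (h : L2 Z ℝ) : H1 D →L[ℝ] H1 Y :=
  ContinuousLinearMap.codRestrict
    (((WithLp.prodContinuousLinearEquiv 2 ℝ (L2 Y ℝ) (L2 Y E)).symm :
      L2 Y ℝ × L2 Y E →L[ℝ] WithLp 2 (L2 Y ℝ × L2 Y E)).comp
      (((c.partialInt h).comp (fnL D)).prod
        ((c.partialInt h).comp (c.fstField.comp (gradL D)))))
    (H1 Y) (fun f => c.isWeakGradient_partialInt h f)

theorem fn_partialH1 (h : L2 Z ℝ) (f : H1 D) :
    H1.fn (c.partialH1 h f) = c.partialInt h (H1.fn f) := rfl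

theorem grad_partialH1 (h : L2 Z ℝ) (f : H1 D) :
    H1.grad (c.partialH1 h f) = c.partialInt h (c.fstField (H1.grad f)) := rfl

theorem partialInt_ae_eq_zero (h : L2 Z ℝ) (f : L2 D ℝ) {K : Set E} (hK : MeasurableSet K)
    (hf : ∀ᵐ x ∂(volume.restrict (D : Set X)), c.fst x ∉ K → f x = 0) :
    ∀ᵐ y ∂(volume.restrict (Y : Set E)), y ∉ K → c.partialInt h f y = 0 := by
  -- Pair the partial integral with its own restriction `g` to the complement of `K`.
  have hm : MemLp (Kᶜ.indicator (c.partialInt h f)) 2 (volume.restrict (Y : Set E)) :=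
    (Lp.memLp _).indicator hK.compl
  set g : L2 Y ℝ := hm.toLp _ with hg
  have hge := hm.coeFn_toLp
  have h1 : ⟪c.partialInt h f, g⟫_ℝ = 0 := by
    rw [inner_partialInt, L2.inner_def, integral_congr_ae (g := fun _ => (0 : ℝ)), integral_zero]
    filter_upwards [hf, c.coeFn_tensor g h, c.ae_fst hge] with x hx1 hx2 hx3
    by_cases hx : c.fst x ∈ K
    · rw [hx2, hg, hx3, Set.indicator_of_notMem (not_not.2 hx), smul_zero, inner_zero_right]
    · rw [hx1 hx, inner_zero_left]
  have h2 : ⟪c.partialInt h f, g⟫_ℝ = ⟪g, g⟫_ℝ := by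
    rw [L2.inner_def, L2.inner_def]
    refine integral_congr_ae ?_
    filter_upwards [hge] with y hy
    rw [hg, hy]
    by_cases hyK : y ∈ Kᶜ <;> simp [hyK]
  have h3 : g = 0 := inner_self_eq_zero.1 (h2.symm.trans h1)
  filter_upwards [hge, Lp.eq_zero_iff_ae_eq_zero.1 h3] with y hy1 hy2 hyK
  have hyK' : y ∈ Kᶜ := hyK
  rw [← hg, hy2, Set.indicator_of_mem hyK'] at hy1
  exact hy1.symm

/-- If `f` vanishes outside `K × Z` for a compact `K ⊆ Y`, its partial integrals are in `H¹₀(Y)`. -/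
theorem partialH1_mem_H10_of_ae_eq_zero (h : L2 Z ℝ) (f : H1 D) {K : Set E} (hK : IsCompact K)
    (hKY : K ⊆ Y) (hf : ∀ᵐ x ∂(volume.restrict (D : Set X)), c.fst x ∉ K → H1.fn f x = 0) :
    c.partialH1 h f ∈ H10 Y :=
  mem_H10_of_ae_eq_zero _ hK hKY (c.partialInt_ae_eq_zero h _ hK.measurableSet hf)

theorem partialH1_testH1_mem_H10 (h : L2 Z ℝ) (Φ : 𝓓(D, ℝ)) : c.partialH1 h (testH1 Φ) ∈ H10 Y := by
  refine c.partialH1_mem_H10_of_ae_eq_zero h _ (K := c.fst '' tsupport Φ)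
    (Φ.hasCompactSupport.isCompact.image c.fst.continuous) ?_ ?_
  · rintro _ ⟨x, hx, rfl⟩
    exact ((c.mem_iff' x).1 (Φ.tsupport_subset hx)).1
  · filter_upwards [coeFn_testFn Φ] with x hx hxK
    rw [fn_testH1, hx]
    exact image_eq_zero_of_notMem_tsupport fun h => hxK ⟨x, h, rfl⟩

theorem partialH1_mem_H10 (h : L2 Z ℝ) {f : H1 D} (hf : f ∈ H10 D) : c.partialH1 h f ∈ H10 Y :=
  H10_induction ((Submodule.isClosed_topologicalClosure _).preimage (c.partialH1 h).continuous)
    (c.partialH1_testH1_mem_H10 h) hf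

/-- The weak derivative of `v ⊗ h` in a direction of the first factor. After the pairing with `h`,
it is the integration by parts of `v` against the partial integral of `Φ`, which is in `H¹₀(Y)`. -/
theorem inner_tensor_component_inl (v : H1 Y) (h : L2 Z ℝ) (Φ : 𝓓(D, ℝ)) (e : E) :
    ⟪c.tensor (H1.fn v) h, component (c.inl e) (testGrad Φ)⟫_ℝ
      = -⟪testFn Φ, c.tensor (component e (H1.grad v)) h⟫_ℝ := by
  rw [real_inner_comm, ← component_fstField, ← inner_partialInt, ← compLpL_partialInt,
    ← inner_partialInt, real_inner_comm]
  exact inner_component_grad_of_mem_H10 v (c.partialH1_testH1_mem_H10 h Φ) e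

/-- The tensor product of Sobolev functions is a Sobolev function, with the gradient given by the
product rule. -/
theorem isWeakGradient_tensor (v : H1 Y) (w : H1 Z) :
    IsWeakGradient D (c.tensor (H1.fn v) (H1.fn w))
      (c.inlField (c.tensor (H1.grad v) (H1.fn w))
        + c.swap.inlField (c.swap.tensor (H1.grad w) (H1.fn v))) := by
  refine isWeakGradient_iff.2 fun Φ x => ?_
  have h1 := c.inner_tensor_component_inl v (H1.fn w) Φ (c.fst x)
  have h2 := c.swap.inner_tensor_component_inl w (H1.fn v) Φ (c.snd x)
  rw [swap_tensor, swap_inl] at h2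
  rw [map_add, component_inlField, component_inlField, component_tensor, component_tensor,
    inner_add_right, neg_add, swap_fst, ← h1, ← h2, ← inner_add_right, ← component_add,
    inl_fst_add_inr_snd]

/-- The tensor product `v ↦ v ⊗ w` with a fixed `w ∈ H¹(Z)` as a map from `H¹(Y)` to `H¹(D)`. -/
def tensorH1 (w : H1 Z) : H1 Y →L[ℝ] H1 D :=
  ContinuousLinearMap.codRestrict
    (((WithLp.prodContinuousLinearEquiv 2 ℝ (L2 D ℝ) (L2 D X)).symm :
      L2 D ℝ × L2 D X →L[ℝ] WithLp 2 (L2 D ℝ × L2 D X)).comp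
      (((c.tensor.flip (H1.fn w)).comp (fnL Y)).prod
        (c.inlField.comp ((c.tensor.flip (H1.fn w)).comp (gradL Y))
          + c.swap.inlField.comp ((c.swap.tensor (H1.grad w)).comp (fnL Y)))))
    (H1 D) (fun v => c.isWeakGradient_tensor v w)

theorem fn_tensorH1 (v : H1 Y) (w : H1 Z) :
    H1.fn (c.tensorH1 w v) = c.tensor (H1.fn v) (H1.fn w) := rfl

theorem grad_tensorH1 (v : H1 Y) (w : H1 Z) :
    H1.grad (c.tensorH1 w v) = c.inlField (c.tensor (H1.grad v) (H1.fn w))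
      + c.swap.inlField (c.swap.tensor (H1.grad w) (H1.fn v)) := rfl

theorem swap_tensorH1 (v : H1 Y) (w : H1 Z) : c.swap.tensorH1 v w = c.tensorH1 w v :=
  H1.eq_of_fn_eq (c.swap_tensor _ _)

/-- The Dirichlet form of `v ⊗ w` against `f` splits into the Dirichlet forms of the factors
against the partial integrals of `f`. -/
theorem inner_grad_tensorH1 (v : H1 Y) (w : H1 Z) (f : H1 D) :
    ⟪H1.grad (c.tensorH1 w v), H1.grad f⟫_ℝ
      = ⟪H1.grad v, H1.grad (c.partialH1 (H1.fn w) f)⟫_ℝ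
        + ⟪H1.grad w, H1.grad (c.swap.partialH1 (H1.fn v) f)⟫_ℝ := by
  rw [grad_tensorH1, inner_add_left, inner_inlField, inner_inlField, grad_partialH1,
    grad_partialH1, real_inner_comm, ← inner_partialInt, real_inner_comm, add_right_inj,
    real_inner_comm, ← inner_partialInt, real_inner_comm]

theorem inner_fn_tensorH1 (v : H1 Y) (w : H1 Z) (f : H1 D) :
    ⟪H1.fn (c.tensorH1 w v), H1.fn f⟫_ℝ = ⟪H1.fn v, H1.fn (c.partialH1 (H1.fn w) f)⟫_ℝ := by
  rw [fn_tensorH1, fn_partialH1, real_inner_comm, ← inner_partialInt, real_inner_comm]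

end ProductChart

end ChartOperators

/-! ### Bases of eigenfunctions -/

section Eigenbasis

/-- An orthogonal family of nonzero vectors of a closed subspace `V` of a Hilbert space, such that
only the zero vector of `V` is orthogonal to the family, is an orthogonal basis of `V`. -/
theorem existsUnique_hasSum_smul_of_orthogonal {H ι : Type*} [NormedAddCommGroup H]
    [InnerProductSpace ℝ H] [CompleteSpace H] {V : Submodule ℝ H} (hV : IsClosed (V : Set H))
    {u : ι → H} (hu : ∀ i, u i ∈ V) (hu0 : ∀ i, u i ≠ 0)
    (horth : Pairwise fun i j => ⟪u i, u j⟫_ℝ = 0)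
    (hcomplete : ∀ g ∈ V, (∀ i, ⟪u i, g⟫_ℝ = 0) → g = 0) {f : H} (hf : f ∈ V) :
    ∃! a : ι → ℝ, HasSum (fun i => a i • u i) f := by
  have : CompleteSpace V := hV.completeSpace_coe
  have hpos : ∀ i, ‖u i‖ ≠ 0 := fun i => norm_ne_zero_iff.2 (hu0 i)
  let e : ι → V := fun i => ‖u i‖⁻¹ • ⟨u i, hu i⟩
  have he : Orthonormal ℝ e := by
    refine ⟨fun i => ?_, fun i j hij => ?_⟩
    · change ‖‖u i‖⁻¹ • u i‖ = 1
      rw [norm_smul, norm_inv, norm_norm, inv_mul_cancel₀ (hpos i)]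
    · change ⟪‖u i‖⁻¹ • u i, ‖u j‖⁻¹ • u j⟫_ℝ = 0
      rw [inner_smul_left, inner_smul_right, horth hij, mul_zero, mul_zero]
  have hbot : (Submodule.span ℝ (Set.range e))ᗮ = ⊥ := by
    refine (Submodule.eq_bot_iff _).2 fun g hg => Subtype.ext (hcomplete g g.2 fun i => ?_)
    have h1 : ⟪‖u i‖⁻¹ • u i, (g : H)⟫_ℝ = 0 :=
      (Submodule.mem_orthogonal _ _).1 hg (e i) (Submodule.subset_span ⟨i, rfl⟩)
    rw [real_inner_smul_left] at h1
    exact (mul_eq_zero.1 h1).resolve_left (inv_ne_zero (hpos i))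
  let b := HilbertBasis.mkOfOrthogonalEqBot he hbot
  have hb : HasSum (fun i => (b.repr ⟨f, hf⟩ i * ‖u i‖⁻¹) • u i) f := by
    have h := (b.hasSum_repr ⟨f, hf⟩).mapL V.subtypeL
    convert! h using 2 with i
    rw [HilbertBasis.coe_mkOfOrthogonalEqBot, mul_smul]
    rfl
  refine ⟨_, hb, fun a ha => ?_⟩
  ext i
  -- Pairing the expansion with `u i` determines the coefficient `a i`.
  have key : ∀ a' : ι → ℝ, HasSum (fun j => a' j • u j) f → ⟪u i, f⟫_ℝ = a' i * ‖u i‖ ^ 2 := by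
    intro a' ha'
    refine (ha'.mapL (innerSL ℝ (u i))).unique ?_
    convert hasSum_single i fun j hj => ?_ using 1
    · rw [innerSL_apply_apply, inner_smul_right, real_inner_self_eq_norm_sq]
    · rw [innerSL_apply_apply, inner_smul_right, horth hj.symm, mul_zero]
  exact mul_right_cancel₀ (pow_ne_zero 2 (hpos i)) ((key a ha).symm.trans (key _ hb))

variable {E : Type*} [NormedAddCommGroup E] [InnerProductSpace ℝ E] [FiniteDimensional ℝ E]
  [MeasurableSpace E] [BorelSpace E] {Ω : Opens E} {ι : Type*}

theorem isOrthonormalBasisL2_iff {u : ι → H1 Ω} : IsOrthonormalBasisL2 u ↔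
    Orthonormal ℝ (fun i => H1.fn (u i)) ∧
      ∀ f : L2 Ω ℝ, (∀ i, ⟪H1.fn (u i), f⟫_ℝ = 0) → f = 0 := by
  refine and_congr_right fun _ => ?_
  rw [Submodule.topologicalClosure_eq_top_iff, Submodule.eq_bot_iff]
  refine forall_congr' fun f => ?_
  rw [Submodule.mem_orthogonal]
  refine imp_congr_left ⟨fun h i => h _ (Submodule.subset_span ⟨i, rfl⟩), fun h g hg => ?_⟩
  induction hg using Submodule.span_induction with
  | mem x hx => obtain ⟨i, rfl⟩ := hx; exact h i
  | zero => exact inner_zero_left _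
  | add x y _ _ hx hy => rw [inner_add_left, hx, hy, add_zero]
  | smul a x _ hx => rw [inner_smul_left, hx, mul_zero]

theorem IsEigenpair.inner_eq {V : Submodule ℝ (H1 Ω)} {Λ : ℝ} {u : H1 Ω} (h : IsEigenpair V Λ u)
    {f : H1 Ω} (hf : f ∈ V) : ⟪u, f⟫_ℝ = (1 + Λ) * ⟪H1.fn u, H1.fn f⟫_ℝ := by
  rw [H1.inner_def, h.2.2 f hf]
  ring

/-- An eigenvalue that is not in the list would have an eigenfunction orthogonal to the basis. -/
theorem eigenvalues_eq_range {V : Submodule ℝ (H1 Ω)} {Λ : ι → ℝ} {u : ι → H1 Ω}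
    (hu : ∀ i, IsEigenpair V (Λ i) (u i)) (hb : IsOrthonormalBasisL2 u) :
    eigenvalues V = Set.range Λ := by
  refine Set.Subset.antisymm ?_ (Set.range_subset_iff.2 fun i => ⟨u i, hu i⟩)
  rintro M ⟨f, hfV, hf0, hf⟩
  by_contra hM
  refine hf0 (H1.eq_of_fn_eq (((isOrthonormalBasisL2_iff.1 hb).2 _ fun i => ?_).trans
    (map_zero (fnL Ω)).symm))
  have h1 := (hu i).2.2 f hfV
  have h2 := hf (u i) (hu i).1
  rw [real_inner_comm, real_inner_comm (H1.fn (u i))] at h2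
  have h3 : (Λ i - M) * ⟪H1.fn (u i), H1.fn f⟫_ℝ = 0 := by linarith
  exact (mul_eq_zero.1 h3).resolve_left fun h => hM ⟨i, sub_eq_zero.1 h⟩

/-- Eigenfunctions that form an orthonormal basis of `L²(Ω)` form an orthogonal basis of the form
domain: on it the `H¹` inner product with an eigenfunction is a positive multiple of the `L²` inner
product. -/
theorem isOrthogonalBasisH1_of_isEigenpair {V : Submodule ℝ (H1 Ω)}
    (hV : IsClosed (V : Set (H1 Ω))) {Λ : ι → ℝ} {u : ι → H1 Ω}
    (hu : ∀ i, IsEigenpair V (Λ i) (u i)) (hb : IsOrthonormalBasisL2 u) :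
    IsOrthogonalBasisH1 V u := by
  have hb' := isOrthonormalBasisL2_iff.1 hb
  have horth : Pairwise fun i j => ⟪u i, u j⟫_ℝ = 0 := by
    intro i j hij
    rw [(hu i).inner_eq (hu j).1, hb'.1.2 hij, mul_zero]
  refine ⟨fun i => (hu i).1, horth, fun f hf => existsUnique_hasSum_smul_of_orthogonal hV
    (fun i => (hu i).1) (fun i => (hu i).2.1) horth (fun g hg h => ?_) hf⟩
  refine H1.eq_of_fn_eq ((hb'.2 _ fun i => ?_).trans (map_zero (fnL Ω)).symm)
  have h1 := h i
  rw [(hu i).inner_eq hg] at h1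
  refine (mul_eq_zero.1 h1).resolve_left fun h0 => (hu i).2.1 ?_
  have h2 := (hu i).inner_eq (hu i).1
  rwa [h0, zero_mul, inner_self_eq_zero] at h2

end Eigenbasis

/-! ### Tensor products and partial integrals in the form domains -/

namespace ProductChart

section Cases

variable {E : Type*} [NormedAddCommGroup E] [InnerProductSpace ℝ E] [FiniteDimensional ℝ E]
  [MeasurableSpace E] [BorelSpace E]
  {F : Type*} [NormedAddCommGroup F] [InnerProductSpace ℝ F] [FiniteDimensional ℝ F]
  [MeasurableSpace F] [BorelSpace F]
  {X : Type*} [NormedAddCommGroup X] [InnerProductSpace ℝ X] [FiniteDimensional ℝ X]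
  [MeasurableSpace X] [BorelSpace X]
  {D : Opens X} {Y : Opens E} {Z : Opens F}

variable (c : ProductChart D Y Z)

theorem norm_sq_eq (x : X) : ‖x‖ ^ 2 = ‖c.fst x‖ ^ 2 + ‖c.snd x‖ ^ 2 := by
  simpa only [real_inner_self_eq_norm_sq] using c.inner_eq x x

theorem dist_fst_le (x x' : X) : dist (c.fst x) (c.fst x') ≤ dist x x' := by
  rw [dist_eq_norm, dist_eq_norm, ← map_sub]
  refine le_of_sq_le_sq ?_ (norm_nonneg _)
  rw [c.norm_sq_eq (x - x')]
  exact le_add_of_nonneg_right (sq_nonneg _)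

/-- The part `∂Y × Z` of the boundary of `D`; for the swapped chart it is the part `Y × ∂Z`. -/
def bdry : Set X := {x | c.fst x ∈ frontier (Y : Set E) ∧ c.snd x ∈ Z}

theorem tensorH1_testH1 (ψ : 𝓓(Y, ℝ)) (χ : 𝓓(Z, ℝ)) :
    c.tensorH1 (testH1 χ) (testH1 ψ) = testH1 (c.testProd ψ χ) :=
  H1.eq_of_fn_eq (c.testFn_testProd ψ χ).symm

theorem tensorH1_mem_H10 {v : H1 Y} (hv : v ∈ H10 Y) {w : H1 Z} (hw : w ∈ H10 Z) :
    c.tensorH1 w v ∈ H10 D := by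
  have hcl : IsClosed (H10 D : Set (H1 D)) := Submodule.isClosed_topologicalClosure _
  refine H10_induction (hcl.preimage (c.tensorH1 w).continuous) (fun ψ => ?_) hv
  rw [← c.swap_tensorH1]
  refine H10_induction (hcl.preimage (c.swap.tensorH1 (testH1 ψ)).continuous) (fun χ => ?_) hw
  change c.swap.tensorH1 (testH1 ψ) (testH1 χ) ∈ H10 D
  rw [c.swap_tensorH1, tensorH1_testH1]
  exact testH1_mem_H10 _

theorem tensorH1_mem_H1Mixed {v : H1 Y} (hv : v ∈ H10 Y) (w : H1 Z) :
    c.tensorH1 w v ∈ H1Mixed D c.bdry := by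
  have hcl : IsClosed (H1Mixed D c.bdry : Set (H1 D)) := Submodule.isClosed_topologicalClosure _
  refine H10_induction (hcl.preimage (c.tensorH1 w).continuous) (fun ψ => ?_) hv
  refine Submodule.le_topologicalClosure _ ?_
  -- The support of `ψ` has a positive distance from `∂Y`.
  obtain ⟨δ, hδ, hδY⟩ := ψ.hasCompactSupport.isCompact.exists_thickening_subset_open Y.isOpen
    ψ.tsupport_subset
  refine ⟨δ, hδ, ?_⟩
  filter_upwards [c.coeFn_tensor (testFn ψ) (H1.fn w), c.ae_fst (coeFn_testFn ψ)] with x h1 h2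
  rintro ⟨x', ⟨hx', -⟩, hxx'⟩
  rw [fn_tensorH1, fn_testH1, h1, h2, image_eq_zero_of_notMem_tsupport (f := ψ) ?_, smul_zero]
  intro hx
  have hY : c.fst x' ∈ (Y : Set E) := hδY (Metric.mem_thickening_iff.2
    ⟨c.fst x, hx, by rw [dist_comm]; exact (c.dist_fst_le x x').trans_lt hxx'⟩)
  rw [Y.isOpen.frontier_eq] at hx'
  exact hx'.2 hY

theorem partialH1_mem_H10_of_mem_H1Mixed (hY : Bornology.IsBounded (Y : Set E)) (h : L2 Z ℝ)
    {f : H1 D} (hf : f ∈ H1Mixed D c.bdry) : c.partialH1 h f ∈ H10 Y := by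
  have hcl : IsClosed {f : H1 D | c.partialH1 h f ∈ H10 Y} :=
    (Submodule.isClosed_topologicalClosure _).preimage (c.partialH1 h).continuous
  refine hcl.closure_subset_iff.2 ?_ hf
  rintro f ⟨ε, hε, hf⟩
  -- The points at distance at least `ε` from `∂Y` form a compact set, because `Y` is bounded.
  let K : Set E := closure (Y : Set E) ∩ ⋂ y' ∈ frontier (Y : Set E), {y | ε ≤ dist y y'}
  have hK : IsCompact K := hY.isCompact_closure.inter_right
    (isClosed_biInter fun y' _ =>
      isClosed_le continuous_const (continuous_id.dist continuous_const))
  have hKY : K ⊆ Y := by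
    rintro y ⟨hy, hy'⟩
    by_contra hyY
    have hfr : y ∈ frontier (Y : Set E) := by
      rw [Y.isOpen.frontier_eq]
      exact ⟨hy, hyY⟩
    have : ε ≤ dist y y := Set.mem_iInter₂.1 hy' y hfr
    rw [dist_self] at this
    exact hε.not_ge this
  refine c.partialH1_mem_H10_of_ae_eq_zero h f hK hKY ?_
  filter_upwards [hf, ae_restrict_mem D.isOpen.measurableSet] with x hx hxD hxK
  obtain ⟨hxY, hxZ⟩ := (c.mem_iff' x).1 hxD
  have : ∃ y' ∈ frontier (Y : Set E), dist (c.fst x) y' < ε := by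
    by_contra! hcon
    exact hxK ⟨subset_closure hxY, Set.mem_iInter₂.2 hcon⟩
  obtain ⟨y', hy', hd⟩ := this
  -- Move `x` to the boundary along the first factor only.
  have h1 : c.fst (c.inl y' + c.inr (c.snd x)) = y' := by
    rw [map_add, c.fst_inl, ← c.swap_inl, ← c.swap_snd, c.swap.snd_inl, add_zero]
  have h2 : c.snd (c.inl y' + c.inr (c.snd x)) = c.snd x := by
    rw [map_add, c.snd_inl, ← c.swap_inl, zero_add]
    exact c.swap.fst_inl _
  refine hx ⟨c.inl y' + c.inr (c.snd x), ⟨by rwa [h1], by rwa [h2]⟩, ?_⟩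
  have h3 : dist x (c.inl y' + c.inr (c.snd x)) = dist (c.fst x) y' := by
    rw [dist_eq_norm, dist_eq_norm]
    refine (pow_left_inj₀ (norm_nonneg _) (norm_nonneg _) two_ne_zero).1 ?_
    rw [c.norm_sq_eq, map_sub, map_sub, h1, h2, sub_self, norm_zero]
    ring
  rwa [h3]

end Cases

end ProductChart

/-! ### Separation of variables -/

section Spectrum

variable {E : Type*} [NormedAddCommGroup E] [InnerProductSpace ℝ E] [FiniteDimensional ℝ E]
  [MeasurableSpace E] [BorelSpace E]
  {F : Type*} [NormedAddCommGroup F] [InnerProductSpace ℝ F] [FiniteDimensional ℝ F]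
  [MeasurableSpace F] [BorelSpace F] {Y : Opens E} {Z : Opens F}

/-- Separation of variables for any form domains that are compatible with tensor products and with
partial integration. -/
theorem hasTensorSpectrum_of_tensor_of_partial (hY : Bornology.IsBounded (Y : Set E))
    (hZ : Bornology.IsBounded (Z : Set F)) {VY : Submodule ℝ (H1 Y)} {VZ : Submodule ℝ (H1 Z)}
    {V : Submodule ℝ (H1 (prodDomain Y Z))} (hV : IsClosed (V : Set (H1 (prodDomain Y Z))))
    (htensor : ∀ v ∈ VY, ∀ w ∈ VZ, (ProductChart.refl Y Z).tensorH1 w v ∈ V)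
    (hfst : ∀ f ∈ V, ∀ h, (ProductChart.refl Y Z).partialH1 h f ∈ VY)
    (hsnd : ∀ f ∈ V, ∀ h, (ProductChart.refl Y Z).swap.partialH1 h f ∈ VZ)
    {lam mu : ℕ → ℝ} {v : ℕ → H1 Y} {w : ℕ → H1 Z} (hv : IsSpectralSequence VY lam v)
    (hw : IsSpectralSequence VZ mu w) : HasTensorSpectrum V lam v mu w := by
  set c := ProductChart.refl Y Z with hc
  have : IsFiniteMeasure (volume.restrict (Y : Set E)) := ⟨by simpa using hY.measure_lt_top⟩
  have : IsFiniteMeasure (volume.restrict (Z : Set F)) := ⟨by simpa using hZ.measure_lt_top⟩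
  obtain ⟨hvo, hvc⟩ := isOrthonormalBasisL2_iff.1 hv.2.2
  obtain ⟨hwo, hwc⟩ := isOrthonormalBasisL2_iff.1 hw.2.2
  let u : ℕ × ℕ → H1 (prodDomain Y Z) := fun i => c.tensorH1 (w i.2) (v i.1)
  have huo : Orthonormal ℝ fun i => H1.fn (u i) := by
    rw [orthonormal_iff_ite] at hvo hwo ⊢
    rintro ⟨j, m⟩ ⟨j', m'⟩
    refine (c.inner_tensor (H1.fn (v j)) (H1.fn (v j')) (H1.fn (w m)) (H1.fn (w m'))).trans ?_
    rw [hvo, hwo]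
    by_cases h1 : j = j' <;> by_cases h2 : m = m' <;> simp [h1, h2]
  have hub : IsOrthonormalBasisL2 u := by
    refine isOrthonormalBasisL2_iff.2 ⟨huo, fun f hf => ?_⟩
    refine eq_zero_of_forall_inner_tensorL_eq_zero c.measEquiv c.measurePreserving f fun g h => ?_
    -- Integrating out `z` against each `w m`, then `y` against `g`, shows `f ⟂ g ⊗ h`.
    have h1 : ∀ m, c.partialInt (H1.fn (w m)) f = 0 := by
      intro m
      refine hvc _ fun j => ?_
      rw [c.inner_partialInt_right]
      exact hf (j, m)
    have h2 : c.swap.partialInt g f = 0 := by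
      refine hwc _ fun m => ?_
      rw [c.swap.inner_partialInt_right, c.swap_tensor, ← c.inner_partialInt_right, h1,
        inner_zero_right]
    change ⟪f, c.tensor g h⟫_ℝ = 0
    rw [← c.swap_tensor, ← c.swap.inner_partialInt, h2, inner_zero_left]
  have hue : ∀ i : ℕ × ℕ, IsEigenpair V (lam i.1 + mu i.2) (u i) := by
    intro i
    refine ⟨htensor _ (hv.2.1 _).1 _ (hw.2.1 _).1, fun h => ?_, fun f hf => ?_⟩
    · have h0 : H1.fn (u i) = 0 := h ▸ map_zero (fnL _)
      exact huo.ne_zero i h0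
    · rw [c.inner_grad_tensorH1, (hv.2.1 i.1).2.2 _ (hfst f hf _),
        (hw.2.1 i.2).2.2 _ (hsnd f hf _), ← c.inner_fn_tensorH1, ← c.swap.inner_fn_tensorH1,
        c.swap_tensorH1]
      ring
  refine ⟨?_, u, fun j m => ?_, fun j m => hue (j, m), hub,
    isOrthogonalBasisH1_of_isEigenpair hV hue hub⟩
  · rw [eigenvalues_eq_range hue hub]
    ext Λ
    simp [eq_comm]
  · filter_upwards [c.coeFn_tensor (H1.fn (v j)) (H1.fn (w m))] with x hx
    exact hx.trans (mul_comm _ _)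

end Spectrum

end ProductSpectrum

end

open ProductSpectrum in
theorem mainTheorem7 {p q : ℕ}
    (Y : TopologicalSpace.Opens (EuclideanSpace ℝ (Fin p)))
    (Z : TopologicalSpace.Opens (EuclideanSpace ℝ (Fin q)))
    (hY : Bornology.IsBounded (Y : Set (EuclideanSpace ℝ (Fin p))))
    (hZ : Bornology.IsBounded (Z : Set (EuclideanSpace ℝ (Fin q))))
    (lam mu : ℕ → ℝ) (v : ℕ → ProductSpectrum.H1 Y) (w : ℕ → ProductSpectrum.H1 Z) :
    -- Dirichlet conditions
    (ProductSpectrum.IsSpectralSequence (ProductSpectrum.H10 Y) lam v →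
      ProductSpectrum.IsSpectralSequence (ProductSpectrum.H10 Z) mu w →
      ProductSpectrum.HasTensorSpectrum
        (ProductSpectrum.H10 (ProductSpectrum.prodDomain Y Z)) lam v mu w) ∧
    -- Neumann conditions
    (ProductSpectrum.IsSpectralSequence (ProductSpectrum.H1Full Y) lam v →
      ProductSpectrum.IsSpectralSequence (ProductSpectrum.H1Full Z) mu w →
      ProductSpectrum.HasTensorSpectrum
        (ProductSpectrum.H1Full (ProductSpectrum.prodDomain Y Z)) lam v mu w) ∧
    -- Dirichlet on `∂Y × Z`, Neumann on `Y × ∂Z`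
    (ProductSpectrum.IsSpectralSequence (ProductSpectrum.H10 Y) lam v →
      ProductSpectrum.IsSpectralSequence (ProductSpectrum.H1Full Z) mu w →
      ProductSpectrum.HasTensorSpectrum
        (ProductSpectrum.H1Mixed (ProductSpectrum.prodDomain Y Z)
          (ProductSpectrum.bdryLeft Y Z)) lam v mu w) ∧
    -- Neumann on `∂Y × Z`, Dirichlet on `Y × ∂Z`
    (ProductSpectrum.IsSpectralSequence (ProductSpectrum.H1Full Y) lam v →
      ProductSpectrum.IsSpectralSequence (ProductSpectrum.H10 Z) mu w →
      ProductSpectrum.HasTensorSpectrum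
        (ProductSpectrum.H1Mixed (ProductSpectrum.prodDomain Y Z)
          (ProductSpectrum.bdryRight Y Z)) lam v mu w) := by

  refine ⟨fun hv hw => ?_, fun hv hw => ?_, fun hv hw => ?_, fun hv hw => ?_⟩
  · exact hasTensorSpectrum_of_tensor_of_partial hY hZ (Submodule.isClosed_topologicalClosure _)
      (fun _ hv _ hw => ProductChart.tensorH1_mem_H10 _ hv hw)
      (fun _ hf h => ProductChart.partialH1_mem_H10 _ h hf)
      (fun _ hf h => ProductChart.partialH1_mem_H10 _ h hf) hv hw
  · exact hasTensorSpectrum_of_tensor_of_partial hY hZ isClosed_univ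
      (fun _ _ _ _ => Submodule.mem_top) (fun _ _ _ => Submodule.mem_top)
      (fun _ _ _ => Submodule.mem_top) hv hw
  · exact hasTensorSpectrum_of_tensor_of_partial hY hZ (Submodule.isClosed_topologicalClosure _)
      (fun _ hv w _ => ProductChart.tensorH1_mem_H1Mixed (ProductChart.refl Y Z) hv w)
      (fun _ hf h =>
        ProductChart.partialH1_mem_H10_of_mem_H1Mixed (ProductChart.refl Y Z) hY h hf)
      (fun _ _ _ => Submodule.mem_top) hv hw
  · have hΓ : bdryRight Y Z = (ProductChart.refl Y Z).swap.bdry := Set.ext fun x => And.comm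
    rw [hΓ]
    exact hasTensorSpectrum_of_tensor_of_partial hY hZ (Submodule.isClosed_topologicalClosure _)
      (fun v _ w hw => by
        rw [← ProductChart.swap_tensorH1]
        exact ProductChart.tensorH1_mem_H1Mixed (ProductChart.refl Y Z).swap hw v)
      (fun _ _ _ => Submodule.mem_top)
      (fun _ hf h => ProductChart.partialH1_mem_H10_of_mem_H1Mixed
        (ProductChart.refl Y Z).swap hZ h hf) hv hw
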